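/- A complex structure on a real Lie algebra $\mathfrak g$ is a linear map $J:\mathfrak g\to\mathfrak g$ with $J^2=-I$ and $[Jx,Jy]-[x,y]-J[Jx,y]-J[x,Jy]=0$ for all $x,y$. A symplectic structure is a nondegenerate alternating bilinear form $\omega$ on $\mathfrak g$ with $\omega([x,y],z)+\omega([y,z],x)+\omega([z,x],y)=0$; it is compatible with $J$ if $\omega(Jx,Jy)=\omega(x,y)$. A Kähler Lie algebra $(\mathfrak g,J,\omega)$ is a real Lie algebra with a complex structure $J$ and a compatible symplectic structure $\omega$ (the metric $\omega(J\cdot,\cdot)$ may be indefinite). Consider the following table of Lie algebras with basis $e_1,e_2,e_3,e_4$ (brackets of basis vectors that are not listed and do not follow by antisymmetry vanish), complex structures $J$ (completed by $J^2=-I$), and sets of two-forms, where $e^{ij}=e^i\wedge e^j$ for the dual basis $(e^i)$, and $a,b,c$ range over the real numbers subject to the stated condition. 1. $\mathbb R\times\mathfrak h_3$: $[e_1,e_2]=e_3$. $Je_1=e_2$, $Je_3=e_4$: $a(e^{13}+e^{24})+b(e^{14}-e^{23})+c\,e^{12}$, $a^2+b^2\ne0$. 2. $\mathbb R^2\times\mathfrak{aff}(\mathbb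 R)$: $[e_1,e_2]=e_2$. $Je_1=e_2$, $Je_3=e_4$: $a\,e^{12}+b\,e^{34}$, $ab\ne0$. 3. $\mathbb R\times\mathfrak e(2)$: $[e_1,e_2]=-e_3$, $[e_1,e_3]=e_2$. $Je_1=e_4$, $Je_2=e_3$: $a\,e^{14}+b\,e^{23}$, $ab\ne0$. 4. $\mathfrak{aff}(\mathbb R)\times\mathfrak{aff}(\mathbb R)$: $[e_1,e_2]=e_2$, $[e_3,e_4]=e_4$. $Je_1=e_2$, $Je_3=e_4$: $a\,e^{12}+b\,e^{34}$, $ab\ne0$. 5. $\mathfrak{aff}(\mathbb C)$: $[e_1,e_3]=e_3$, $[e_1,e_4]=e_4$, $[e_2,e_3]=e_4$, $[e_2,e_4]=-e_3$. $J_1e_1=e_3$, $J_1e_2=e_4$: $a(e^{13}-e^{24})+b(e^{14}+e^{23})$, $a^2+b^2\ne0$. $J_2e_1=-e_2$, $J_2e_3=e_4$: $a(e^{13}-e^{24})+b(e^{14}+e^{23})+c\,e^{12}$, $a^2+b^2\ne0$. 6. $\mathfrak r_{4,-1,-1}$: $[e_4,e_1]=e_1$, $[e_4,e_2]=-e_2$,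 $[e_4,e_3]=-e_3$. $Je_4=e_1$, $Je_2=e_3$: $a(e^{12}+e^{34})+b(e^{13}-e^{24})+c\,e^{14}$, $a^2+b^2\ne0$. 7. $\mathfrak r'_{4,0,\delta}$, $\delta>0$: $[e_4,e_1]=e_1$, $[e_4,e_2]=-\delta e_3$, $[e_4,e_3]=\delta e_2$. Two complex structures, $J_1e_4=e_1$, $J_1e_2=e_3$ and $J_2e_4=e_1$, $J_2e_2=-e_3$; for each of them: $a\,e^{14}+b\,e^{23}$, $ab\ne0$. 8. $\mathfrak d_{4,1}$: $[e_1,e_2]=e_3$, $[e_4,e_3]=e_3$, $[e_4,e_1]=e_1$. $Je_1=e_4$, $Je_2=e_3$: $a(e^{12}-e^{34})+b\,e^{14}$, $a\ne0$. 9. $\mathfrak d_{4,2}$: $[e_1,e_2]=e_3$, $[e_4,e_3]=e_3$, $[e_4,e_1]=2e_1$, $[e_4,e_2]=-e_2$. $J_1e_4=-e_2$, $J_1e_1=e_3$: $a(e^{14}+e^{23})+b\,e^{24}$, $a\ne0$. $J_2e_4=-2e_1$, $J_2e_2=e_3$: $a\,e^{14}+b\,e^{23}$, $ab\ne0$. 10.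 $\mathfrak d_{4,1/2}$: $[e_1,e_2]=e_3$, $[e_4,e_3]=e_3$, $[e_4,e_1]=\tfrac12e_1$, $[e_4,e_2]=\tfrac12e_2$. Two complex structures, $J_1e_4=e_3$, $J_1e_1=e_2$ and $J_2e_4=e_3$, $J_2e_1=-e_2$; for each of them: $a(e^{12}-e^{34})$, $a\ne0$. 11. $\mathfrak d'_{4,\delta}$, $\delta>0$: $[e_1,e_2]=e_3$, $[e_4,e_1]=\tfrac\delta2e_1-e_2$, $[e_4,e_2]=e_1+\tfrac\delta2e_2$, $[e_4,e_3]=\delta e_3$. Four complex structures, $J_1e_4=e_3$, $J_1e_1=e_2$; $J_2e_4=-e_3$, $J_2e_1=e_2$; $J_3e_4=-e_3$, $J_3e_1=-e_2$; $J_4e_4=e_3$, $J_4e_1=-e_2$; for each of them: $a(e^{12}-\delta e^{34})$, $a\ne0$. **Proposition.** (i) Let $(\mathfrak g,J,\omega)$ be a non-abelian four-dimensional Kähler Lie algebra. Then there are a Lie algebra $\mathfrak g_0$ of the table, a complex structure $J_0$ listed for it, and a Lie algebra isomorphism $\varphi:\mathfrak g\to\mathfrak g_0$ with $\varphi\circ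 J=J_0\circ\varphi$ such that $\omega=\varphi^*\omega_0$ for one of the two-forms $\omega_0$ listed for $(\mathfrak g_0,J_0)$. (ii) If $\mathfrak g_0$ is a Lie algebra of the table and $J$ is a complex structure on $\mathfrak g_0$ that admits a compatible symplectic structure, then there are an automorphism $\varphi$ of $\mathfrak g_0$ and a complex structure $J_0$ listed for $\mathfrak g_0$ with $\varphi\circ J=J_0\circ\varphi$. (iii) Every listed $J_0$ is a complex structure on the corresponding $\mathfrak g_0$, and the symplectic structures on $\mathfrak g_0$ compatible with $J_0$ are exactly the listed two-forms. -/

import Mathlib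

/-- An integrable almost complex structure on a real Lie algebra: `J ^ 2 = -1` and `N_J = 0`. -/
def IsComplexStructure {g : Type*} [LieRing g] [LieAlgebra ℝ g] (J : g →ₗ[ℝ] g) : Prop :=
  (∀ x, J (J x) = -x) ∧
    ∀ x y, ⁅J x, J y⁆ - ⁅x, y⁆ - J ⁅J x, y⁆ - J ⁅x, J y⁆ = 0

/-- A symplectic structure on a (finite-dimensional) real Lie algebra: an alternating bilinear form
which is closed for the Lie algebra differential and nondegenerate. -/
def IsSymplecticStructure {g : Type*} [LieRing g] [LieAlgebra ℝ g]
    (ω : LinearMap.BilinForm ℝ g) : Prop :=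
  (∀ x, ω x x = 0) ∧
    (∀ x y z, ω ⁅x, y⁆ z + ω ⁅y, z⁆ x + ω ⁅z, x⁆ y = 0) ∧
    ∀ x, (∀ y, ω x y = 0) → x = 0

/-- The set of symplectic structures compatible with `J`, i.e. with `ω (J x) (J y) = ω x y`. -/
def compatibleSymplectic {g : Type*} [LieRing g] [LieAlgebra ℝ g] (J : g →ₗ[ℝ] g) :
    Set (LinearMap.BilinForm ℝ g) :=
  {ω | IsSymplecticStructure ω ∧ ∀ x y, ω (J x) (J y) = ω x y}

/-- A Kähler structure on a real Lie algebra: a complex structure and a compatible symplectic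
structure. -/
def IsKahlerStructure {g : Type*} [LieRing g] [LieAlgebra ℝ g] (J : g →ₗ[ℝ] g)
    (ω : LinearMap.BilinForm ℝ g) : Prop :=
  IsComplexStructure J ∧ ω ∈ compatibleSymplectic J

/-- Names of families of four-dimensional solvable real Lie algebras. -/
inductive LieName : Type
  /-- `ℝ × h₃`: `[e₁,e₂] = e₃`. -/
  | rh3
  /-- `ℝ × r_{3,a}`: `[e₁,e₂] = e₂`, `[e₁,e₃] = a e₃`. -/
  | rr3 (a : ℝ)
  /-- `ℝ × r'_{3,c}`: `[e₁,e₂] = c e₂ - e₃`, `[e₁,e₃] = e₂ + c e₃`. -/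
  | rr3' (c : ℝ)
  /-- `aff(ℝ) × aff(ℝ)`: `[e₁,e₂] = e₂`, `[e₃,e₄] = e₄`. -/
  | r2r2
  /-- `aff(ℂ)`: `[e₁,e₃] = e₃`, `[e₁,e₄] = e₄`, `[e₂,e₃] = e₄`, `[e₂,e₄] = -e₃`. -/
  | r2'
  /-- `r_{4,a,b}`: `[e₄,e₁] = e₁`, `[e₄,e₂] = a e₂`, `[e₄,e₃] = b e₃`. -/
  | r4 (a b : ℝ)
  /-- `r'_{4,c,δ}`: `[e₄,e₁] = e₁`, `[e₄,e₂] = c e₂ - δ e₃`, `[e₄,e₃] = δ e₂ + c e₃`. -/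
  | r4' (c δ : ℝ)
  /-- `d_{4,a}`: `[e₁,e₂] = e₃`, `[e₄,e₃] = e₃`, `[e₄,e₁] = a e₁`, `[e₄,e₂] = (1 - a) e₂`. -/
  | d4 (a : ℝ)
  /-- `d'_{4,δ}`: `[e₁,e₂] = e₃`, `[e₄,e₁] = (δ/2) e₁ - e₂`, `[e₄,e₃] = δ e₃`,
  `[e₄,e₂] = e₁ + (δ/2) e₂`. -/
  | d4' (δ : ℝ)

namespace LieName

/-- The bracket in the coordinates `(x 0, x 1, x 2, x 3)` with respect to `e₁, e₂, e₃, e₄`. -/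
noncomputable def bracket (A : LieName) (x y : Fin 4 → ℝ) : Fin 4 → ℝ :=
  let p : Fin 4 → Fin 4 → ℝ := fun i j => x i * y j - x j * y i
  match A with
  | rh3 => ![0, 0, p 0 1, 0]
  | rr3 a => ![0, p 0 1, a * p 0 2, 0]
  | rr3' c => ![0, c * p 0 1 + p 0 2, -p 0 1 + c * p 0 2, 0]
  | r2r2 => ![0, p 0 1, 0, p 2 3]
  | r2' => ![0, 0, p 0 2 - p 1 3, p 0 3 + p 1 2]
  | r4 a b => ![p 3 0, a * p 3 1, b * p 3 2, 0]
  | r4' c δ => ![p 3 0, c * p 3 1 + δ * p 3 2, -δ * p 3 1 + c * p 3 2, 0]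
  | d4 a => ![a * p 3 0, (1 - a) * p 3 1, p 0 1 + p 3 2, 0]
  | d4' δ => ![δ / 2 * p 3 0 + p 3 1, -p 3 0 + δ / 2 * p 3 1, p 0 1 + δ * p 3 2, 0]

/-- The underlying space `ℝ⁴` of the Lie algebra with name `A` (a type synonym that carries the
bracket of `A`). -/
def Alg (_A : LieName) : Type := Fin 4 → ℝ

variable (A : LieName)

noncomputable instance : AddCommGroup A.Alg := inferInstanceAs (AddCommGroup (Fin 4 → ℝ))

noncomputable instance : Module ℝ A.Alg := inferInstanceAs (Module ℝ (Fin 4 → ℝ))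

noncomputable instance : Bracket A.Alg A.Alg := ⟨fun x y => A.bracket x y⟩

theorem bracket_add_left (x y z : Fin 4 → ℝ) :
    A.bracket (x + y) z = A.bracket x z + A.bracket y z := by
  cases A <;> ext i <;> fin_cases i <;> simp [bracket] <;> ring

theorem bracket_add_right (x y z : Fin 4 → ℝ) :
    A.bracket x (y + z) = A.bracket x y + A.bracket x z := by
  cases A <;> ext i <;> fin_cases i <;> simp [bracket] <;> ring

theorem bracket_self (x : Fin 4 → ℝ) : A.bracket x x = 0 := by
  cases A <;> ext i <;> fin_cases i <;> simp [bracket, mul_comm]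

theorem bracket_smul_right (t : ℝ) (x y : Fin 4 → ℝ) :
    A.bracket x (t • y) = t • A.bracket x y := by
  cases A <;> ext i <;> fin_cases i <;> simp [bracket] <;> ring

theorem bracket_leibniz (x y z : Fin 4 → ℝ) :
    A.bracket x (A.bracket y z) = A.bracket (A.bracket x y) z + A.bracket y (A.bracket x z) := by
  cases A <;> ext i <;> fin_cases i <;> simp [bracket] <;> ring

noncomputable instance : LieRing A.Alg where
  add_lie := A.bracket_add_left
  lie_add := A.bracket_add_right
  lie_self := A.bracket_self
  leibniz_lie := A.bracket_leibniz

noncomputable instance : LieAlgebra ℝ A.Alg where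
  lie_smul := A.bracket_smul_right

/-- The basis `e₁, e₂, e₃, e₄` of `A.Alg`. -/
noncomputable def basis : Module.Basis (Fin 4) ℝ A.Alg := Pi.basisFun ℝ (Fin 4)

/-- `A.e 0, A.e 1, A.e 2, A.e 3` are `e₁, e₂, e₃, e₄` (the index is shifted by one). -/
noncomputable def e (i : Fin 4) : A.Alg := A.basis i

/-- The dual basis: `A.dual 0, A.dual 1, A.dual 2, A.dual 3` are `e¹, e², e³, e⁴`. -/
noncomputable def dual (i : Fin 4) : A.Alg →ₗ[ℝ] ℝ := A.basis.coord i

/-- The two-forms `e^{ij} = e^i ∧ e^j`, with indices shifted by one: `A.w 0 1` is `e^{12}`. -/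
noncomputable def w (i j : Fin 4) : LinearMap.BilinForm ℝ A.Alg :=
  LinearMap.BilinForm.linMulLin (A.dual i) (A.dual j) -
    LinearMap.BilinForm.linMulLin (A.dual j) (A.dual i)

/-- The endomorphism with `e₁ ↦ v₁`, `e₂ ↦ v₂`, `e₃ ↦ v₃`, `e₄ ↦ v₄`. -/
noncomputable def endo (v₁ v₂ v₃ v₄ : A.Alg) : A.Alg →ₗ[ℝ] A.Alg :=
  A.basis.constr ℝ ![v₁, v₂, v₃, v₄]

end LieName

open LieName in
/-- The table of Kähler Lie algebras. `KahlerTable A J S` says that the Lie algebra `A`, the complex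
structure `J` on it, and the set `S` of two-forms form a line of the table.
In the code the indices of `e` and `w` run from `0` to `3`; in the comments they run from `1` to `4`. -/
inductive KahlerTable :
    (A : LieName) → (A.Alg →ₗ[ℝ] A.Alg) → Set (LinearMap.BilinForm ℝ A.Alg) → Prop
  /-- `ℝ × h₃`: `J e₁ = e₂`, `J e₃ = e₄`. -/
  | rh3 : KahlerTable rh3 (endo rh3 (e _ 1) (-e _ 0) (e _ 3) (-e _ 2))
      {ω | ∃ a b c : ℝ, a ^ 2 + b ^ 2 ≠ 0 ∧
        ω = a • (w _ 0 2 + w _ 1 3) + b • (w _ 0 3 - w _ 1 2) + c • w _ 0 1}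
  /-- `ℝ² × aff(ℝ)`: `J e₁ = e₂`, `J e₃ = e₄`. -/
  | rr30 : KahlerTable (rr3 0) (endo (rr3 0) (e _ 1) (-e _ 0) (e _ 3) (-e _ 2))
      {ω | ∃ a b : ℝ, a * b ≠ 0 ∧ ω = a • w _ 0 1 + b • w _ 2 3}
  /-- `ℝ × e(2)`: `J e₁ = e₄`, `J e₂ = e₃`. -/
  | rr30' : KahlerTable (rr3' 0) (endo (rr3' 0) (e _ 3) (e _ 2) (-e _ 1) (-e _ 0))
      {ω | ∃ a b : ℝ, a * b ≠ 0 ∧ ω = a • w _ 0 3 + b • w _ 1 2}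
  /-- `aff(ℝ) × aff(ℝ)`: `J e₁ = e₂`, `J e₃ = e₄`. -/
  | r2r2 : KahlerTable r2r2 (endo r2r2 (e _ 1) (-e _ 0) (e _ 3) (-e _ 2))
      {ω | ∃ a b : ℝ, a * b ≠ 0 ∧ ω = a • w _ 0 1 + b • w _ 2 3}
  /-- `aff(ℂ)`: `J₁ e₁ = e₃`, `J₁ e₂ = e₄`. -/
  | r2'_J1 : KahlerTable r2' (endo r2' (e _ 2) (e _ 3) (-e _ 0) (-e _ 1))
      {ω | ∃ a b : ℝ, a ^ 2 + b ^ 2 ≠ 0 ∧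
        ω = a • (w _ 0 2 - w _ 1 3) + b • (w _ 0 3 + w _ 1 2)}
  /-- `aff(ℂ)`: `J₂ e₁ = -e₂`, `J₂ e₃ = e₄`. -/
  | r2'_J2 : KahlerTable r2' (endo r2' (-e _ 1) (e _ 0) (e _ 3) (-e _ 2))
      {ω | ∃ a b c : ℝ, a ^ 2 + b ^ 2 ≠ 0 ∧
        ω = a • (w _ 0 2 - w _ 1 3) + b • (w _ 0 3 + w _ 1 2) + c • w _ 0 1}
  /-- `r_{4,-1,-1}`: `J e₄ = e₁`, `J e₂ = e₃`. -/
  | r4 : KahlerTable (r4 (-1) (-1)) (endo (r4 (-1) (-1)) (-e _ 3) (e _ 2) (-e _ 1) (e _ 0))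
      {ω | ∃ a b c : ℝ, a ^ 2 + b ^ 2 ≠ 0 ∧
        ω = a • (w _ 0 1 + w _ 2 3) + b • (w _ 0 2 - w _ 1 3) + c • w _ 0 3}
  /-- `r'_{4,0,δ}`: `J₁ e₄ = e₁`, `J₁ e₂ = e₃`. -/
  | r4'_J1 (δ : ℝ) (hδ : 0 < δ) :
      KahlerTable (r4' 0 δ) (endo (r4' 0 δ) (-e _ 3) (e _ 2) (-e _ 1) (e _ 0))
      {ω | ∃ a b : ℝ, a * b ≠ 0 ∧ ω = a • w _ 0 3 + b • w _ 1 2}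
  /-- `r'_{4,0,δ}`: `J₂ e₄ = e₁`, `J₂ e₂ = -e₃`. -/
  | r4'_J2 (δ : ℝ) (hδ : 0 < δ) :
      KahlerTable (r4' 0 δ) (endo (r4' 0 δ) (-e _ 3) (-e _ 2) (e _ 1) (e _ 0))
      {ω | ∃ a b : ℝ, a * b ≠ 0 ∧ ω = a • w _ 0 3 + b • w _ 1 2}
  /-- `d_{4,1}`: `J e₁ = e₄`, `J e₂ = e₃`. -/
  | d41 : KahlerTable (d4 1) (endo (d4 1) (e _ 3) (e _ 2) (-e _ 1) (-e _ 0))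
      {ω | ∃ a b : ℝ, a ≠ 0 ∧ ω = a • (w _ 0 1 - w _ 2 3) + b • w _ 0 3}
  /-- `d_{4,2}`: `J₁ e₄ = -e₂`, `J₁ e₁ = e₃`. -/
  | d42_J1 : KahlerTable (d4 2) (endo (d4 2) (e _ 2) (e _ 3) (-e _ 0) (-e _ 1))
      {ω | ∃ a b : ℝ, a ≠ 0 ∧ ω = a • (w _ 0 3 + w _ 1 2) + b • w _ 1 3}
  /-- `d_{4,2}`: `J₂ e₄ = -2 e₁`, `J₂ e₂ = e₃`. -/
  | d42_J2 : KahlerTable (d4 2)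
      (endo (d4 2) ((1 / 2 : ℝ) • e _ 3) (e _ 2) (-e _ 1) ((-2 : ℝ) • e _ 0))
      {ω | ∃ a b : ℝ, a * b ≠ 0 ∧ ω = a • w _ 0 3 + b • w _ 1 2}
  /-- `d_{4,1/2}`: `J₁ e₄ = e₃`, `J₁ e₁ = e₂`. -/
  | d4half_J1 : KahlerTable (d4 (1 / 2)) (endo (d4 (1 / 2)) (e _ 1) (-e _ 0) (-e _ 3) (e _ 2))
      {ω | ∃ a : ℝ, a ≠ 0 ∧ ω = a • (w _ 0 1 - w _ 2 3)}
  /-- `d_{4,1/2}`: `J₂ e₄ = e₃`, `J₂ e₁ = -e₂`. -/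
  | d4half_J2 : KahlerTable (d4 (1 / 2)) (endo (d4 (1 / 2)) (-e _ 1) (e _ 0) (-e _ 3) (e _ 2))
      {ω | ∃ a : ℝ, a ≠ 0 ∧ ω = a • (w _ 0 1 - w _ 2 3)}
  /-- `d'_{4,δ}`: `J₁ e₄ = e₃`, `J₁ e₁ = e₂`. -/
  | d4'_J1 (δ : ℝ) (hδ : 0 < δ) :
      KahlerTable (d4' δ) (endo (d4' δ) (e _ 1) (-e _ 0) (-e _ 3) (e _ 2))
      {ω | ∃ a : ℝ, a ≠ 0 ∧ ω = a • (w _ 0 1 - δ • w _ 2 3)}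
  /-- `d'_{4,δ}`: `J₂ e₄ = -e₃`, `J₂ e₁ = e₂`. -/
  | d4'_J2 (δ : ℝ) (hδ : 0 < δ) :
      KahlerTable (d4' δ) (endo (d4' δ) (e _ 1) (-e _ 0) (e _ 3) (-e _ 2))
      {ω | ∃ a : ℝ, a ≠ 0 ∧ ω = a • (w _ 0 1 - δ • w _ 2 3)}
  /-- `d'_{4,δ}`: `J₃ e₄ = -e₃`, `J₃ e₁ = -e₂`. -/
  | d4'_J3 (δ : ℝ) (hδ : 0 < δ) :
      KahlerTable (d4' δ) (endo (d4' δ) (-e _ 1) (e _ 0) (e _ 3) (-e _ 2))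
      {ω | ∃ a : ℝ, a ≠ 0 ∧ ω = a • (w _ 0 1 - δ • w _ 2 3)}
  /-- `d'_{4,δ}`: `J₄ e₄ = e₃`, `J₄ e₁ = -e₂`. -/
  | d4'_J4 (δ : ℝ) (hδ : 0 < δ) :
      KahlerTable (d4' δ) (endo (d4' δ) (-e _ 1) (e _ 0) (-e _ 3) (e _ 2))
      {ω | ∃ a : ℝ, a ≠ 0 ∧ ω = a • (w _ 0 1 - δ • w _ 2 3)}

/-!
Regard a Kähler Lie algebra as a complex plane `V`, `J` being multiplication by `I`. Integrability
of `J` says that `⁅x, y⁆ = S x y + M x y - M y x` with `S` complex bilinear and `M` antilinear in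
the first and linear in the second argument. If `h` is the pseudo-hermitian form with imaginary part
`ω`, closedness of `ω` says that `S` is determined by `M` and `h`. The Jacobi identity gives
`M x ∘ M y - M y ∘ M x = M (S x y)`, so the `M x` span a solvable Lie algebra of endomorphisms and
by Lie's theorem they have a common eigenvector. If it is null for `h`, complete it to a hyperbolic
pair, otherwise to an orthogonal basis. The Jacobi identity is then a system of equations for six
complex structure constants, whose solutions are brought to the lines of the table by changes of
basis. Two algebras of the table are never isomorphic, since the traces of `ad x`, `(ad x) ^ 2`
and `(ad x) ^ 3` tell them apart.
-/

theorem isAlt_ext_basis {ι R M N : Type*} [LinearOrder ι] [CommRing R] [AddCommGroup M] [Module R M]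
    [AddCommGroup N] [Module R N] {B C : M →ₗ[R] M →ₗ[R] N} (hB : B.IsAlt) (hC : C.IsAlt)
    (b : Module.Basis ι R M) (h : ∀ i j, i < j → B (b i) (b j) = C (b i) (b j)) : B = C := by
  refine LinearMap.ext_basis b b fun i j => ?_
  rcases lt_trichotomy i j with hij | rfl | hij
  · exact h i j hij
  · rw [hB.self_eq_zero, hC.self_eq_zero]
  · rw [← hB.neg, ← hC.neg, h j i hij]

theorem separatingLeft_iff_pfaffian_ne_zero {K V : Type*} [Field K] [AddCommGroup V] [Module K V]
    {B : LinearMap.BilinForm K V} (hB : B.IsAlt) (b : Module.Basis (Fin 4) K V) :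
    B.SeparatingLeft ↔ B (b 0) (b 1) * B (b 2) (b 3) - B (b 0) (b 2) * B (b 1) (b 3) +
      B (b 0) (b 3) * B (b 1) (b 2) ≠ 0 := by
  have hdet : (LinearMap.toMatrix₂ b b B).det = (B (b 0) (b 1) * B (b 2) (b 3) -
      B (b 0) (b 2) * B (b 1) (b 3) + B (b 0) (b 3) * B (b 1) (b 2)) ^ 2 := by
    have hmat : LinearMap.toMatrix₂ b b B =
        !![0, B (b 0) (b 1), B (b 0) (b 2), B (b 0) (b 3);
          -B (b 0) (b 1), 0, B (b 1) (b 2), B (b 1) (b 3);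
          -B (b 0) (b 2), -B (b 1) (b 2), 0, B (b 2) (b 3);
          -B (b 0) (b 3), -B (b 1) (b 3), -B (b 2) (b 3), 0] := by
      ext i j
      rw [LinearMap.toMatrix₂_apply]
      fin_cases i <;> fin_cases j <;>
        first | exact hB.self_eq_zero _ | rfl | exact (hB.neg_eq _ _).symm
    rw [hmat]
    rw [Matrix.det_succ_row_zero]
    simp [Fin.sum_univ_four, Matrix.det_fin_three, Fin.succAbove]
    ring
  rw [LinearMap.separatingLeft_iff_det_ne_zero b, hdet, pow_ne_zero_iff two_ne_zero]

theorem alternating_eq_zero {ι : Type*} [LinearOrder ι] {t : ι → ι → ι → ℝ}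
    (hrot : ∀ i j k, t i j k = t j k i) (hswap : ∀ i j k, t i j k = -t j i k)
    (h : ∀ i j k, i < j → j < k → t i j k = 0) (i j k : ι) : t i j k = 0 := by
  have hself i k : t i i k = 0 := by linarith [hswap i i k]
  have hmin {i j k} (hij : i < j) (hik : i < k) : t i j k = 0 := by
    rcases lt_trichotomy j k with hjk | rfl | hkj
    · exact h i j k hij hjk
    · rw [hrot, hself]
    · rw [hrot, hswap, ← hrot, h i k j hik hkj, neg_zero]
  rcases lt_trichotomy i j with hij | rfl | hji
  · rcases lt_trichotomy i k with hik | rfl | hki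
    · exact hmin hij hik
    · rw [hrot, hrot, hself]
    · rw [hrot, hrot, hmin hki (hki.trans hij)]
  · exact hself i k
  · rcases lt_trichotomy j k with hjk | rfl | hkj
    · rw [hrot, hmin hjk hji]
    · rw [hrot, hself]
    · rw [hrot, hrot, hmin (hkj.trans hji) hkj]

theorem closed_iff_forall_basis {ι g : Type*} [LinearOrder ι] [LieRing g] [LieAlgebra ℝ g]
    (ω : LinearMap.BilinForm ℝ g) (b : Module.Basis ι ℝ g) :
    (∀ x y z, ω ⁅x, y⁆ z + ω ⁅y, z⁆ x + ω ⁅z, x⁆ y = 0) ↔ ∀ i j k, i < j → j < k →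
      ω ⁅b i, b j⁆ (b k) + ω ⁅b j, b k⁆ (b i) + ω ⁅b k, b i⁆ (b j) = 0 := by
  refine ⟨fun h i j k _ _ => h _ _ _, fun h => ?_⟩
  let T (x y z : g) : ℝ := ω ⁅x, y⁆ z + ω ⁅y, z⁆ x + ω ⁅z, x⁆ y
  have hrot (x y z) : T x y z = T y z x := by ring
  have hswap (x y z) : T x y z = -T y x z := by
    simp only [T, ← lie_skew y x, ← lie_skew x z, ← lie_skew z y, map_neg, LinearMap.neg_apply]
    ring
  have hext (y z) (hb : ∀ i, T (b i) y z = 0) (x) : T x y z = 0 := by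
    let f : g →ₗ[ℝ] ℝ := IsLinearMap.mk' (fun x => T x y z)
      ⟨fun u v => by simp only [T, add_lie, lie_add, map_add, LinearMap.add_apply]; ring,
        fun c u => by
          simp only [T, smul_lie, lie_smul, map_smul, LinearMap.smul_apply, smul_eq_mul]; ring⟩
    exact LinearMap.congr_fun (b.ext (f₁ := f) (f₂ := 0) hb) x
  have hbasis (i j k) : T (b i) (b j) (b k) = 0 :=
    alternating_eq_zero (t := fun i j k => T (b i) (b j) (b k)) (fun _ _ _ => hrot _ _ _)
      (fun _ _ _ => hswap _ _ _) h i j k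
  exact fun x y z => hext _ _ (fun i => (hrot _ _ _).trans <| hext _ _ (fun j => (hrot _ _ _).trans
    <| hext _ _ (fun k => hbasis k i j) z) y) x

theorem isComplexStructure_iff_forall_basis {ι g : Type*} [LinearOrder ι] [LieRing g]
    [LieAlgebra ℝ g] {J : g →ₗ[ℝ] g} (b : Module.Basis ι ℝ g) :
    IsComplexStructure J ↔ (∀ i, J (J (b i)) = -b i) ∧ ∀ i j, i < j →
      ⁅J (b i), J (b j)⁆ - ⁅b i, b j⁆ - J ⁅J (b i), b j⁆ - J ⁅b i, J (b j)⁆ = 0 := by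
  refine ⟨fun h => ⟨fun i => h.1 _, fun i j _ => h.2 _ _⟩, fun ⟨hJ, hN⟩ => ⟨fun x => ?_, ?_⟩⟩
  · exact LinearMap.congr_fun (b.ext (f₁ := J ∘ₗ J) (f₂ := -LinearMap.id) hJ) x
  · let N : g →ₗ[ℝ] g →ₗ[ℝ] g := LinearMap.mk₂ ℝ
      (fun x y => ⁅J x, J y⁆ - ⁅x, y⁆ - J ⁅J x, y⁆ - J ⁅x, J y⁆)
      (fun x y z => by simp only [map_add, add_lie]; abel)
      (fun c x y => by simp only [map_smul, smul_lie, smul_sub])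
      (fun x y z => by simp only [map_add, lie_add]; abel)
      (fun c x y => by simp only [map_smul, lie_smul, smul_sub])
    have halt : N.IsAlt := fun x => by
      simp only [N, LinearMap.mk₂_apply, ← lie_skew x (J x), lie_self, map_neg]
      abel
    have hzero : N = 0 := isAlt_ext_basis halt (fun _ => rfl) b hN
    exact fun x y => LinearMap.congr_fun₂ hzero x y

theorem mem_compatibleSymplectic_iff_forall_basis {g : Type*} [LieRing g] [LieAlgebra ℝ g]
    {J : g →ₗ[ℝ] g} {ω : LinearMap.BilinForm ℝ g} (hω : ω.IsAlt) (b : Module.Basis (Fin 4) ℝ g) :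
    ω ∈ compatibleSymplectic J ↔
      ((∀ i j k, i < j → j < k →
          ω ⁅b i, b j⁆ (b k) + ω ⁅b j, b k⁆ (b i) + ω ⁅b k, b i⁆ (b j) = 0) ∧
        ∀ i j, i < j → ω (J (b i)) (J (b j)) = ω (b i) (b j)) ∧
      ω (b 0) (b 1) * ω (b 2) (b 3) - ω (b 0) (b 2) * ω (b 1) (b 3) +
          ω (b 0) (b 3) * ω (b 1) (b 2) ≠ 0 := by
  have hinv : (∀ x y, ω (J x) (J y) = ω x y) ↔
      ∀ i j, i < j → ω (J (b i)) (J (b j)) = ω (b i) (b j) :=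
    ⟨fun h i j _ => h _ _, fun h => LinearMap.congr_fun₂ <|
      isAlt_ext_basis (B := ω.compl₁₂ J J) (fun x => hω (J x)) hω b h⟩
  have hself : ∀ x, ω x x = 0 := hω
  rw [← closed_iff_forall_basis, ← hinv, ← separatingLeft_iff_pfaffian_ne_zero hω]
  simp only [compatibleSymplectic, IsSymplecticStructure, Set.mem_ofPred_eq,
    LinearMap.SeparatingLeft]
  tauto

theorem forall_lt_fin_four {p : Fin 4 → Fin 4 → Prop} :
    (∀ i j, i < j → p i j) ↔ p 0 1 ∧ p 0 2 ∧ p 0 3 ∧ p 1 2 ∧ p 1 3 ∧ p 2 3 := by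
  refine ⟨fun h => ⟨h 0 1 ?_, h 0 2 ?_, h 0 3 ?_, h 1 2 ?_, h 1 3 ?_, h 2 3 ?_⟩, ?_⟩
  any_goals decide
  rintro ⟨_, _, _, _, _, _⟩ i j hij
  fin_cases i <;> fin_cases j <;> first | assumption | exact absurd hij (by decide)

theorem forall_lt_lt_fin_four {p : Fin 4 → Fin 4 → Fin 4 → Prop} :
    (∀ i j k, i < j → j < k → p i j k) ↔ p 0 1 2 ∧ p 0 1 3 ∧ p 0 2 3 ∧ p 1 2 3 := by
  refine ⟨fun h => ⟨h 0 1 2 ?_ ?_, h 0 1 3 ?_ ?_, h 0 2 3 ?_ ?_, h 1 2 3 ?_ ?_⟩, ?_⟩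
  any_goals decide
  rintro ⟨_, _, _, _⟩ i j k hij hjk
  fin_cases i <;> fin_cases j <;> fin_cases k <;>
    first | assumption | exact absurd hij (by decide) | exact absurd hjk (by decide)

namespace LieName

variable {A : LieName}

theorem lie_apply (x y : A.Alg) (i : Fin 4) : ⁅x, y⁆ i = A.bracket x y i := rfl

theorem zero_apply (i : Fin 4) : (0 : A.Alg) i = 0 := rfl

theorem neg_apply (x : A.Alg) (i : Fin 4) : (-x) i = -x i := rfl

theorem sub_apply (x y : A.Alg) (i : Fin 4) : (x - y) i = x i - y i := rfl

theorem smul_apply (t : ℝ) (x : A.Alg) (i : Fin 4) : (t • x) i = t * x i := rfl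

theorem ext_iff {x y : A.Alg} : x = y ↔ x 0 = y 0 ∧ x 1 = y 1 ∧ x 2 = y 2 ∧ x 3 = y 3 :=
  funext_iff.trans <| by simp only [Fin.forall_fin_succ, Fin.forall_fin_zero, and_true]; rfl

theorem e_eq_single (i : Fin 4) : A.e i = Pi.single i (1 : ℝ) :=
  Pi.basisFun_apply ℝ (Fin 4) i

theorem e_apply (i j : Fin 4) : A.e i j = if j = i then 1 else 0 :=
  (congrFun (e_eq_single i) j).trans (Pi.single_apply i 1 j)

theorem endo_e (v₁ v₂ v₃ v₄ : A.Alg) (i : Fin 4) :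
    A.endo v₁ v₂ v₃ v₄ (A.e i) = ![v₁, v₂, v₃, v₄] i :=
  A.basis.constr_basis ℝ _ i

theorem endo_apply (v₁ v₂ v₃ v₄ x : A.Alg) (i : Fin 4) :
    A.endo v₁ v₂ v₃ v₄ x i = x 0 * v₁ i + x 1 * v₂ i + x 2 * v₃ i + x 3 * v₄ i := by
  rw [endo, Module.Basis.constr_apply_fintype, Fin.sum_univ_four]
  rfl

theorem w_apply (i j : Fin 4) (x y : A.Alg) : A.w i j x y = x i * y j - x j * y i := rfl

theorem w_self (i j : Fin 4) (x : A.Alg) : A.w i j x x = 0 := by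
  rw [w_apply]; ring

theorem isComplexStructure_iff {J : A.Alg →ₗ[ℝ] A.Alg} :
    IsComplexStructure J ↔ (∀ i, J (J (A.e i)) = -A.e i) ∧ ∀ i j, i < j →
      ⁅J (A.e i), J (A.e j)⁆ - ⁅A.e i, A.e j⁆ - J ⁅J (A.e i), A.e j⁆ - J ⁅A.e i, J (A.e j)⁆ = 0 :=
  isComplexStructure_iff_forall_basis A.basis

/-- The two-form on `A` with coefficients `a, b, c, d, e, f` on `e¹², e¹³, e¹⁴, e²³, e²⁴, e³⁴`. -/
noncomputable def form (A : LieName) (a b c d e f : ℝ) : LinearMap.BilinForm ℝ A.Alg :=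
  a • A.w 0 1 + b • A.w 0 2 + c • A.w 0 3 + d • A.w 1 2 + e • A.w 1 3 + f • A.w 2 3

theorem form_apply (a b c d e f : ℝ) (x y : A.Alg) : A.form a b c d e f x y =
    a * (x 0 * y 1 - x 1 * y 0) + b * (x 0 * y 2 - x 2 * y 0) + c * (x 0 * y 3 - x 3 * y 0) +
      d * (x 1 * y 2 - x 2 * y 1) + e * (x 1 * y 3 - x 3 * y 1) + f * (x 2 * y 3 - x 3 * y 2) :=
  rfl

theorem isAlt_form (a b c d e f : ℝ) : (A.form a b c d e f).IsAlt := fun x => by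
  rw [form_apply]; ring

theorem form_e (a b c d e f : ℝ) (i j : Fin 4) : A.form a b c d e f (A.e i) (A.e j) =
    !![0, a, b, c; -a, 0, d, e; -b, -d, 0, f; -c, -e, -f, 0] i j := by
  fin_cases i <;> fin_cases j <;> simp [form_apply, e_apply]

theorem form_eq_iff {a b c d e f : ℝ} {ω : LinearMap.BilinForm ℝ A.Alg} :
    A.form a b c d e f = ω ↔ (∀ x, ω x x = 0) ∧ a = ω (A.e 0) (A.e 1) ∧ b = ω (A.e 0) (A.e 2) ∧
      c = ω (A.e 0) (A.e 3) ∧ d = ω (A.e 1) (A.e 2) ∧ e = ω (A.e 1) (A.e 3) ∧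
      f = ω (A.e 2) (A.e 3) := by
  constructor
  · rintro rfl
    exact ⟨isAlt_form _ _ _ _ _ _, by simp [form_e]⟩
  · rintro ⟨hω, rfl, rfl, rfl, rfl, rfl, rfl⟩
    refine isAlt_ext_basis (isAlt_form _ _ _ _ _ _) hω A.basis ?_
    exact forall_lt_fin_four.mpr ⟨form_e _ _ _ _ _ _ _ _, form_e _ _ _ _ _ _ _ _,
      form_e _ _ _ _ _ _ _ _, form_e _ _ _ _ _ _ _ _, form_e _ _ _ _ _ _ _ _,
      form_e _ _ _ _ _ _ _ _⟩

theorem form_mem_compatibleSymplectic_iff {J : A.Alg →ₗ[ℝ] A.Alg} {a b c d e f : ℝ} :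
    A.form a b c d e f ∈ compatibleSymplectic J ↔
      ((∀ i j k, i < j → j < k → A.form a b c d e f ⁅A.e i, A.e j⁆ (A.e k) +
          A.form a b c d e f ⁅A.e j, A.e k⁆ (A.e i) +
          A.form a b c d e f ⁅A.e k, A.e i⁆ (A.e j) = 0) ∧
        ∀ i j, i < j → A.form a b c d e f (J (A.e i)) (J (A.e j)) =
          A.form a b c d e f (A.e i) (A.e j)) ∧
      a * f - b * e + c * d ≠ 0 := by
  refine (mem_compatibleSymplectic_iff_forall_basis (isAlt_form a b c d e f) A.basis).trans ?_
  refine and_congr Iff.rfl (not_congr ?_)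
  change A.form _ _ _ _ _ _ (A.e 0) (A.e 1) * A.form _ _ _ _ _ _ (A.e 2) (A.e 3) -
    A.form _ _ _ _ _ _ (A.e 0) (A.e 2) * A.form _ _ _ _ _ _ (A.e 1) (A.e 3) +
    A.form _ _ _ _ _ _ (A.e 0) (A.e 3) * A.form _ _ _ _ _ _ (A.e 1) (A.e 2) = 0 ↔ _
  simp only [form_e]
  rfl

theorem compatibleSymplectic_eq_of_form {J : A.Alg →ₗ[ℝ] A.Alg}
    {S : Set (LinearMap.BilinForm ℝ A.Alg)} (hS : ∀ ω ∈ S, ω.IsAlt)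
    (h : ∀ a b c d e f, A.form a b c d e f ∈ compatibleSymplectic J ↔ A.form a b c d e f ∈ S) :
    compatibleSymplectic J = S := by
  have key {ω : LinearMap.BilinForm ℝ A.Alg} (hω : ω.IsAlt) :
      ω ∈ compatibleSymplectic J ↔ ω ∈ S := by
    rw [← form_eq_iff.mpr ⟨hω, rfl, rfl, rfl, rfl, rfl, rfl⟩, h]
  exact Set.ext fun ω => ⟨fun hω => (key hω.1.1).mp hω, fun hω => (key (hS ω hω)).mpr hω⟩

end LieName

namespace KahlerTable

open LieName

variable {A : LieName} {J : A.Alg →ₗ[ℝ] A.Alg} {S : Set (LinearMap.BilinForm ℝ A.Alg)}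

set_option maxHeartbeats 1000000 in
theorem isComplexStructure (h : KahlerTable A J S) : IsComplexStructure J := by
  rw [isComplexStructure_iff, forall_lt_fin_four]
  cases h <;>
    simp [LieName.ext_iff, lie_apply, bracket, zero_apply, neg_apply, sub_apply, smul_apply,
      e_apply, endo_apply] <;>
    norm_num

theorem isAlt (h : KahlerTable A J S) : ∀ ω ∈ S, ω.IsAlt := by
  cases h <;> rintro ω hω x <;> simp only [Set.mem_ofPred_eq] at hω <;>
    grind [LinearMap.add_apply, LinearMap.sub_apply, LinearMap.smul_apply, smul_eq_mul, w_self]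

set_option maxHeartbeats 4000000 in
theorem compatibleSymplectic_eq (h : KahlerTable A J S) : compatibleSymplectic J = S := by
  refine compatibleSymplectic_eq_of_form h.isAlt fun a b c d e f => ?_
  simp only [form_mem_compatibleSymplectic_iff, forall_lt_lt_fin_four, forall_lt_fin_four]
  cases h <;> simp only [Set.mem_ofPred_eq, form_eq_iff, endo_e, LinearMap.add_apply,
      LinearMap.sub_apply, LinearMap.smul_apply, w_self, smul_zero, sub_zero, add_zero,
      implies_true, true_and] <;>
    simp [form_apply, lie_apply, bracket, neg_apply, smul_apply, e_apply, w_apply,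
      -not_and, -not_or]
  case r4'_J1 δ _ | r4'_J2 δ _ =>
    have hδ : δ ^ 2 + 1 ≠ 0 := by positivity
    grind
  case d4'_J1 δ _ | d4'_J2 δ _ | d4'_J3 δ _ | d4'_J4 δ _ =>
    have hδ : (3 / 2 * δ) ^ 2 + 1 ≠ 0 := by positivity
    grind
  all_goals grind

end KahlerTable

/-- The trace of `(ad x) ^ k`. -/
noncomputable def adTrace {g : Type*} [LieRing g] [LieAlgebra ℝ g] (k : ℕ) (x : g) : ℝ :=
  LinearMap.trace ℝ g (LieAlgebra.ad ℝ g x ^ k)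

theorem adTrace_equiv {g h : Type*} [LieRing g] [LieAlgebra ℝ g] [LieRing h] [LieAlgebra ℝ h]
    (φ : g ≃ₗ⁅ℝ⁆ h) (k : ℕ) (x : g) : adTrace k (φ x) = adTrace k x := by
  have hpow : φ.toLinearEquiv.conj (LieAlgebra.ad ℝ g x) ^ k =
      φ.toLinearEquiv.conj (LieAlgebra.ad ℝ g x ^ k) :=
    (map_pow φ.toLinearEquiv.conjRingEquiv _ k).symm
  rw [adTrace, adTrace, ← LieAlgebra.conj_ad_apply, hpow, LinearMap.trace_conj']

theorem LieName.adTrace_eq_sum {A : LieName} (k : ℕ) (x : A.Alg) :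
    adTrace k x = ∑ i, (A.bracket x)^[k] (Pi.single i 1) i := by
  rw [adTrace, LinearMap.trace_eq_matrix_trace ℝ A.basis, Matrix.trace]
  refine Finset.sum_congr rfl fun i _ => ?_
  rw [Matrix.diag_apply, LinearMap.toMatrix_apply, Module.End.pow_apply, ← e_eq_single]
  rfl

/-- The possible shapes of the trace functions `x ↦ tr (ad x) ^ k`, for `k = 1, 2, 3`, on the
Lie algebras of the table; `TraceType.Holds` spells them out. In `ratio p q` the functions for
`k = 2` and `k = 3` are `p` and `q` times a power of the function for `k = 1`. -/
inductive TraceType : Type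
  | zero
  | imaginary
  | twoReal
  | complex
  | ratio (p q : ℝ)

namespace TraceType

variable {g h : Type*} [LieRing g] [LieAlgebra ℝ g] [LieRing h] [LieAlgebra ℝ h]

/-- `t.Holds g` says that the Lie algebra `g` has trace type `t`. -/
def Holds (g : Type*) [LieRing g] [LieAlgebra ℝ g] : TraceType → Prop
  | zero => ∀ x : g, adTrace 1 x = 0 ∧ adTrace 2 x = 0
  | imaginary => (∀ x : g, adTrace 1 x = 0) ∧ ∃ x : g, adTrace 2 x < 0
  | twoReal => (∃ x : g, adTrace 1 x = 1) ∧ (∃ x : g, adTrace 1 x = 0 ∧ 0 < adTrace 2 x) ∧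
      ∀ x : g, adTrace 1 x = 0 → 0 ≤ adTrace 2 x
  | complex => (∃ x : g, adTrace 1 x = 1) ∧ ∃ x : g, adTrace 1 x = 0 ∧ adTrace 2 x < 0
  | ratio p q => (∃ x : g, adTrace 1 x = 1) ∧
      ∀ x : g, adTrace 2 x = p * adTrace 1 x ^ 2 ∧ adTrace 3 x = q * adTrace 1 x ^ 3

theorem Holds.congr (φ : g ≃ₗ⁅ℝ⁆ h) {t : TraceType} (ht : t.Holds g) : t.Holds h := by
  have hφ (k x) : adTrace k (φ.toLieHom x) = adTrace k x := adTrace_equiv φ k x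
  cases t <;> simp only [Holds, φ.surjective.forall, φ.surjective.exists, hφ] <;> exact ht

theorem Holds.unique {s t : TraceType} (hs : s.Holds g) (ht : t.Holds g) : s = t := by
  cases s <;> cases t
  case ratio.ratio p q p' q' =>
    obtain ⟨⟨x, hx⟩, hpq⟩ := hs
    have hp := (hpq x).1.symm.trans (ht.2 x).1
    have hq := (hpq x).2.symm.trans (ht.2 x).2
    simp only [hx, one_pow, mul_one] at hp hq
    rw [hp, hq]
  all_goals first
    | rfl
    | simp only [Holds] at hs ht
      exfalso
      grind

end TraceType

namespace LieName

/-- The trace types of the Lie algebras of the table. -/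
noncomputable def traceType : LieName → TraceType
  | rh3 => .zero
  | rr3 _ => .ratio 1 1
  | rr3' _ => .imaginary
  | r2r2 => .twoReal
  | r2' => .complex
  | r4 _ _ => .ratio 3 1
  | r4' _ δ => .ratio (1 - 2 * δ ^ 2) 1
  | d4 a => .ratio ((1 + a ^ 2 + (1 - a) ^ 2) / 4) ((1 + a ^ 3 + (1 - a) ^ 3) / 8)
  | d4' δ => .ratio (3 / 8 - 1 / (2 * δ ^ 2)) (5 / 32 - 3 / (8 * δ ^ 2))

/-- The names of the Lie algebras of the table. -/
inductive IsTabulated : LieName → Prop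
  | rh3 : IsTabulated rh3
  | rr30 : IsTabulated (rr3 0)
  | rr30' : IsTabulated (rr3' 0)
  | r2r2 : IsTabulated r2r2
  | r2' : IsTabulated r2'
  | r4 : IsTabulated (r4 (-1) (-1))
  | r4' (δ : ℝ) (hδ : 0 < δ) : IsTabulated (r4' 0 δ)
  | d41 : IsTabulated (d4 1)
  | d42 : IsTabulated (d4 2)
  | d4half : IsTabulated (d4 (1 / 2))
  | d4' (δ : ℝ) (hδ : 0 < δ) : IsTabulated (d4' δ)

namespace IsTabulated

theorem traceType_holds {A : LieName} (h : A.IsTabulated) : A.traceType.Holds A.Alg := by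
  cases h
  case rh3 =>
    intro x
    simp [adTrace_eq_sum, Fin.sum_univ_four, bracket]
  case rr30 =>
    refine ⟨⟨e _ 0, ?_⟩, fun x => ⟨?_, ?_⟩⟩ <;>
      simp [adTrace_eq_sum, Fin.sum_univ_four, bracket, e_apply] <;> ring
  case rr30' =>
    refine ⟨fun x => ?_, e _ 0, ?_⟩ <;>
      simp [adTrace_eq_sum, Fin.sum_univ_four, bracket, e_apply]
  case r2r2 =>
    refine ⟨⟨e _ 0, ?_⟩, ⟨e _ 0 - e _ 2, ?_, ?_⟩, fun x _ => ?_⟩ <;>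
      simp [adTrace_eq_sum, Fin.sum_univ_four, bracket, sub_apply, e_apply]
    exact add_nonneg (mul_self_nonneg _) (mul_self_nonneg _)
  case r2' =>
    refine ⟨⟨(1 / 2 : ℝ) • e _ 0, ?_⟩, e _ 1, ?_, ?_⟩ <;>
      simp [adTrace_eq_sum, Fin.sum_univ_four, bracket, smul_apply, e_apply] <;>
      norm_num
  case r4 =>
    refine ⟨⟨-e _ 3, ?_⟩, fun x => ⟨?_, ?_⟩⟩ <;>
      simp [adTrace_eq_sum, Fin.sum_univ_four, bracket, neg_apply, e_apply] <;> ring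
  case r4' δ _ =>
    refine ⟨⟨e _ 3, ?_⟩, fun x => ⟨?_, ?_⟩⟩ <;>
      simp [adTrace_eq_sum, Fin.sum_univ_four, bracket, e_apply] <;> ring
  case d41 | d42 | d4half =>
    refine ⟨⟨(1 / 2 : ℝ) • e _ 3, ?_⟩, fun x => ⟨?_, ?_⟩⟩ <;>
      simp [adTrace_eq_sum, Fin.sum_univ_four, bracket, smul_apply, e_apply] <;>
      ring
  case d4' δ hδ =>
    refine ⟨⟨(1 / (2 * δ) : ℝ) • e _ 3, ?_⟩, fun x => ⟨?_, ?_⟩⟩ <;>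
      simp [adTrace_eq_sum, Fin.sum_univ_four, bracket, smul_apply, e_apply] <;>
      field_simp <;> ring

theorem eq_of_traceType_eq {A B : LieName} (hA : A.IsTabulated) (hB : B.IsTabulated)
    (h : A.traceType = B.traceType) : A = B := by
  have hdiv (δ : ℝ) : 3 / (8 * δ ^ 2) = 3 / 4 * (1 / (2 * δ ^ 2)) := by ring
  have hpos {δ : ℝ} (hδ : 0 < δ) : 0 < δ ^ 2 ∧ 0 < 1 / (2 * δ ^ 2) :=
    ⟨by positivity, by positivity⟩
  rcases hA with _ | _ | _ | _ | _ | _ | ⟨δ, hδ⟩ | _ | _ | _ | ⟨δ, hδ⟩ <;>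
    rcases hB with _ | _ | _ | _ | _ | _ | ⟨δ', hδ'⟩ | _ | _ | _ | ⟨δ', hδ'⟩ <;>
    simp only [traceType, TraceType.ratio.injEq, reduceCtorEq, hdiv] at h
  case r4'.r4' | d4'.d4' =>
    have hsq : δ ^ 2 = δ' ^ 2 := by simpa using h.1
    rw [(pow_left_inj₀ hδ.le hδ'.le two_ne_zero).mp hsq]
  all_goals first
    | rfl
    | linarith [h.1, h.2]
    | linarith [h.1, h.2, hpos hδ]
    | linarith [h.1, h.2, hpos hδ']

theorem eq_of_equiv {A B : LieName} (hA : A.IsTabulated) (hB : B.IsTabulated)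
    (φ : A.Alg ≃ₗ⁅ℝ⁆ B.Alg) : A = B :=
  hA.eq_of_traceType_eq hB <| (hA.traceType_holds.congr φ).unique hB.traceType_holds

end IsTabulated

end LieName

theorem KahlerTable.isTabulated {A : LieName} {J : A.Alg →ₗ[ℝ] A.Alg}
    {S : Set (LinearMap.BilinForm ℝ A.Alg)} (h : KahlerTable A J S) : A.IsTabulated := by
  cases h <;> constructor <;> assumption

/-- The Lie bracket as a bilinear map. -/
def lieBilinear (R L : Type*) [CommRing R] [LieRing L] [LieAlgebra R L] : L →ₗ[R] L →ₗ[R] L :=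
  LinearMap.mk₂ R (⁅·, ·⁆) add_lie smul_lie lie_add lie_smul

section ComplexStructure

open Complex ComplexConjugate

variable {U V W : Type*} [AddCommGroup U] [Module ℝ U] [Module ℂ U] [IsScalarTower ℝ ℂ U]
  [AddCommGroup V] [Module ℝ V] [Module ℂ V] [IsScalarTower ℝ ℂ V]
  [AddCommGroup W] [Module ℝ W] [Module ℂ W] [IsScalarTower ℝ ℂ W]

omit [Module ℝ V] [IsScalarTower ℝ ℂ V] in
theorem I_smul_I_smul (x : V) : I • I • x = -x := by
  rw [smul_smul, I_mul_I, neg_one_smul]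

theorem complex_smul_eq (c : ℂ) (x : V) : c • x = c.re • x + c.im • I • x := by
  conv_lhs => rw [← re_add_im c]
  rw [add_smul, mul_smul]
  exact congrArg₂ (· + ·) (algebraMap_smul ℂ c.re x) (algebraMap_smul ℂ c.im (I • x))

theorem map_complex_smul (f : V →ₗ[ℝ] W) (hf : ∀ x, f (I • x) = I • f x) (c : ℂ) (x : V) :
    f (c • x) = c • f x := by
  simp only [complex_smul_eq c, map_add, map_smul, hf]

theorem map_conj_smul (f : V →ₗ[ℝ] W) (hf : ∀ x, f (I • x) = -(I • f x)) (c : ℂ) (x : V) :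
    f (c • x) = conj c • f x := by
  simp only [complex_smul_eq c x, complex_smul_eq (conj c), map_add, map_smul, hf, conj_re,
    conj_im, smul_neg, neg_smul]

/-- Multiplication by `I` as a real endomorphism. -/
noncomputable def mulI (V : Type*) [AddCommGroup V] [Module ℝ V] [Module ℂ V]
    [IsScalarTower ℝ ℂ V] : V →ₗ[ℝ] V :=
  Algebra.lsmul ℝ ℝ V I

theorem mulI_apply (x : V) : mulI V x = I • x := rfl

/-- A real bilinear map which commutes with `I` in both arguments, as a complex bilinear map. -/
noncomputable def complexBilinear (f : U →ₗ[ℝ] V →ₗ[ℝ] W)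
    (hl : ∀ x y, f (I • x) y = I • f x y) (hr : ∀ x y, f x (I • y) = I • f x y) :
    U →ₗ[ℂ] V →ₗ[ℂ] W :=
  LinearMap.mk₂ ℂ (fun x y => f x y) (fun _ _ _ => f.map_add₂ _ _ _)
    (fun c x y => map_complex_smul (f.flip y) (fun x => hl x y) c x)
    (fun _ _ _ => map_add _ _ _) (fun c x y => map_complex_smul (f x) (hr x) c y)

/-- A real bilinear map which anticommutes with `I` in the first and commutes with `I` in the
second argument, as a sesquilinear map. -/
noncomputable def complexSesquilinear (f : U →ₗ[ℝ] V →ₗ[ℝ] W)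
    (hl : ∀ x y, f (I • x) y = -(I • f x y)) (hr : ∀ x y, f x (I • y) = I • f x y) :
    U →ₗ⋆[ℂ] V →ₗ[ℂ] W :=
  LinearMap.mk₂'ₛₗ (starRingEnd ℂ) (RingHom.id ℂ) (fun x y => f x y)
    (fun _ _ _ => f.map_add₂ _ _ _)
    (fun c x y => map_conj_smul (f.flip y) (fun x => hl x y) c x)
    (fun _ _ _ => map_add _ _ _) (fun c x y => map_complex_smul (f x) (hr x) c y)

end ComplexStructure

section Splitting

open Complex ComplexConjugate

variable {V : Type*} [LieRing V] [LieAlgebra ℝ V] [Module ℂ V]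

/-- The decomposition of a Lie bracket as the sum of a complex bilinear map `S` and the
antisymmetrization of a sesquilinear map `M`. -/
structure HolomorphicSplitting (V : Type*) [LieRing V] [LieAlgebra ℝ V] [Module ℂ V] where
  /-- The complex bilinear part of the bracket. -/
  S : V →ₗ[ℂ] V →ₗ[ℂ] V
  /-- The sesquilinear map which gives the rest of the bracket. -/
  M : V →ₗ⋆[ℂ] V →ₗ[ℂ] V
  S_self : ∀ x, S x x = 0
  lie_eq : ∀ x y, ⁅x, y⁆ = S x y + M x y - M y x

variable [IsScalarTower ℝ ℂ V]

theorem isComplexStructure_mulI_iff : IsComplexStructure (mulI V) ↔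
    ∀ x y : V, ⁅I • x, I • y⁆ - ⁅x, y⁆ - I • ⁅I • x, y⁆ - I • ⁅x, I • y⁆ = 0 :=
  and_iff_right I_smul_I_smul

/-- The component of the bracket which is complex bilinear if `I` is integrable. -/
noncomputable def bilinearPart (V : Type*) [LieRing V] [LieAlgebra ℝ V] [Module ℂ V]
    [IsScalarTower ℝ ℂ V] : V →ₗ[ℝ] V →ₗ[ℝ] V :=
  let ad := lieBilinear ℝ V
  (1 / 2 : ℝ) • (ad - ad.compl₁₂ (mulI V) (mulI V))

theorem bilinearPart_apply (x y : V) :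
    bilinearPart V x y = (1 / 2 : ℝ) • (⁅x, y⁆ - ⁅I • x, I • y⁆) := rfl

/-- The component of the bracket which is antilinear in the first and linear in the second
argument. -/
noncomputable def sesquilinearPart (V : Type*) [LieRing V] [LieAlgebra ℝ V] [Module ℂ V]
    [IsScalarTower ℝ ℂ V] : V →ₗ[ℝ] V →ₗ[ℝ] V :=
  let ad := lieBilinear ℝ V
  let J := mulI V
  (1 / 4 : ℝ) • (ad + ad.compl₁₂ J J - (ad.compl₂ J).compr₂ J + (ad.compl₁₂ J .id).compr₂ J)

theorem sesquilinearPart_apply (x y : V) : sesquilinearPart V x y =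
    (1 / 4 : ℝ) • (⁅x, y⁆ + ⁅I • x, I • y⁆ - I • ⁅x, I • y⁆ + I • ⁅I • x, y⁆) := rfl

theorem lie_eq_bilinearPart_add_sesquilinearPart_sub (x y : V) :
    ⁅x, y⁆ = bilinearPart V x y + sesquilinearPart V x y - sesquilinearPart V y x := by
  rw [bilinearPart_apply, sesquilinearPart_apply, sesquilinearPart_apply, ← lie_skew x y,
    ← lie_skew (I • x) y, ← lie_skew x (I • y), ← lie_skew (I • x) (I • y)]
  simp only [smul_neg]
  module

theorem sesquilinearPart_I_smul_left (x y : V) :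
    sesquilinearPart V (I • x) y = -(I • sesquilinearPart V x y) := by
  rw [sesquilinearPart_apply, sesquilinearPart_apply, smul_comm I (_ : ℝ)]
  simp only [I_smul_I_smul, smul_sub, smul_add, neg_lie, smul_neg]
  abel

theorem sesquilinearPart_I_smul_right (x y : V) :
    sesquilinearPart V x (I • y) = I • sesquilinearPart V x y := by
  rw [sesquilinearPart_apply, sesquilinearPart_apply, smul_comm I (_ : ℝ)]
  simp only [I_smul_I_smul, smul_sub, smul_add, lie_neg, smul_neg]
  abel

theorem bilinearPart_I_smul_right (hI : IsComplexStructure (mulI V)) (x y : V) :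
    bilinearPart V x (I • y) = I • bilinearPart V x y := by
  have h := isComplexStructure_mulI_iff.1 hI x (I • y)
  rw [bilinearPart_apply, bilinearPart_apply, smul_comm I (_ : ℝ)]
  simp only [I_smul_I_smul, lie_neg, smul_neg, smul_sub] at h ⊢
  linear_combination (norm := module) (-1 / 2 : ℝ) • h

theorem bilinearPart_I_smul_left (hI : IsComplexStructure (mulI V)) (x y : V) :
    bilinearPart V (I • x) y = I • bilinearPart V x y := by
  have skew (x y : V) : bilinearPart V x y = -bilinearPart V y x := by
    rw [bilinearPart_apply, bilinearPart_apply, ← lie_skew x, ← lie_skew (I • x)]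
    module
  rw [skew, bilinearPart_I_smul_right hI, skew y, smul_neg, neg_neg]

/-- The splitting of the bracket which comes from the integrability of `I`. -/
noncomputable def IsComplexStructure.splitting (hI : IsComplexStructure (mulI V)) :
    HolomorphicSplitting V where
  S := complexBilinear (bilinearPart V) (bilinearPart_I_smul_left hI)
    (bilinearPart_I_smul_right hI)
  M := complexSesquilinear (sesquilinearPart V) sesquilinearPart_I_smul_left
    sesquilinearPart_I_smul_right
  S_self x := by
    change bilinearPart V x x = 0
    rw [bilinearPart_apply, lie_self, lie_self, sub_zero, smul_zero]
  lie_eq := lie_eq_bilinearPart_add_sesquilinearPart_sub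

end Splitting

theorem isSolvable_of_forall_lie_mem_span {K L : Type*} [Field K] [LieRing L] [LieAlgebra K L]
    (z : L) (h : ∀ x y : L, ⁅x, y⁆ ∈ K ∙ z) : LieAlgebra.IsSolvable L := by
  let J : LieIdeal K L := { K ∙ z with lie_mem := fun _ => h _ _ }
  have hJ : LieAlgebra.derivedSeries K L 1 ≤ J :=
    (LieSubmodule.lie_le_iff ..).2 fun x _ y _ => h x y
  refine LieAlgebra.IsSolvable.mk (R := K) (k := 2) ?_
  refine (LieSubmodule.lie_eq_bot_iff ..).2 fun x hx y hy => ?_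
  obtain ⟨a, rfl⟩ := Submodule.mem_span_singleton.1 (hJ hx)
  obtain ⟨b, rfl⟩ := Submodule.mem_span_singleton.1 (hJ hy)
  rw [smul_lie, lie_smul, lie_self, smul_zero, smul_zero]

namespace HolomorphicSplitting

open Complex ComplexConjugate

variable {V : Type*} [LieRing V] [LieAlgebra ℝ V] [Module ℂ V] (D : HolomorphicSplitting V)

theorem S_skew (x y : V) : D.S x y = -D.S y x := by
  have h := D.S_self (x + y)
  simp only [map_add, LinearMap.add_apply, D.S_self, zero_add, add_zero] at h
  exact eq_neg_of_add_eq_zero_right h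

/- This and the next identity are components of the Jacobi identity: substituting `I • x` for `x`
and so on separates its terms by their linearity or antilinearity in each argument. -/
theorem M_commutator (x y t : V) : D.M x (D.M y t) - D.M y (D.M x t) = D.M (D.S x y) t := by
  have f₁ := leibniz_lie x y t
  have f₂ := leibniz_lie (I • x) y t
  have f₃ := leibniz_lie x (I • y) t
  have f₄ := leibniz_lie (I • x) (I • y) t
  simp only [D.lie_eq, map_add, map_sub, LinearMap.add_apply, LinearMap.sub_apply, map_smulₛₗ,
    LinearMap.smul_apply, conj_I, neg_smul, smul_neg, RingHom.id_apply,
    LinearMap.neg_apply, map_neg, smul_add, smul_sub, I_smul_I_smul] at f₁ f₂ f₃ f₄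
  have g₂ := congrArg (I • ·) f₂
  have g₃ := congrArg (I • ·) f₃
  simp only [smul_add, smul_sub, smul_neg, I_smul_I_smul] at g₂ g₃
  linear_combination (norm := module) (1 / 4 : ℂ) • (f₁ + g₂ + g₃ - f₄)

theorem M_S (x y z : V) : D.M z (D.S x y) =
    D.S x (D.M z y) + D.S (D.M z x) y + D.M (D.M y z) x - D.M (D.M x z) y := by
  have f₁ := leibniz_lie x y z
  have f₂ := leibniz_lie (I • x) y z
  have f₃ := leibniz_lie x (I • y) z
  have f₄ := leibniz_lie (I • x) (I • y) z
  have f₅ := leibniz_lie x y (I • z)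
  have f₆ := leibniz_lie (I • x) y (I • z)
  have f₇ := leibniz_lie x (I • y) (I • z)
  have f₈ := leibniz_lie (I • x) (I • y) (I • z)
  simp only [D.lie_eq, map_add, map_sub, LinearMap.add_apply, LinearMap.sub_apply, map_smulₛₗ,
    LinearMap.smul_apply, conj_I, neg_smul, smul_neg, RingHom.id_apply,
    LinearMap.neg_apply, map_neg, smul_add, smul_sub, I_smul_I_smul] at f₁ f₂ f₃ f₄ f₅ f₆ f₇ f₈
  have g₂ := congrArg (I • ·) f₂
  have g₃ := congrArg (I • ·) f₃
  have g₅ := congrArg (I • ·) f₅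
  have g₈ := congrArg (I • ·) f₈
  simp only [smul_add, smul_sub, smul_neg, I_smul_I_smul] at g₂ g₃ g₅ g₈
  rw [D.S_skew (D.M z x) y]
  linear_combination (norm := module)
    (1 / 8 : ℂ) • (f₁ - g₂ - g₃ - f₄ + g₅ + f₆ + f₇ - g₈)

attribute [local instance] LieRing.ofAssociativeRing

/-- The Lie algebra of endomorphisms formed by the values of `M`. -/
def rangeM : LieSubalgebra ℂ (Module.End ℂ V) where
  __ := LinearMap.range D.M
  lie_mem' := by
    rintro _ _ ⟨x, rfl⟩ ⟨y, rfl⟩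
    exact ⟨D.S x y, LinearMap.ext fun t => (D.M_commutator x y t).symm⟩

theorem exists_S_mem_span (hV : Module.finrank ℂ V = 2) :
    ∃ s, ∀ x y, D.S x y ∈ ℂ ∙ s := by
  have : FiniteDimensional ℂ V := Module.finite_of_finrank_eq_succ hV
  let b := Module.finBasisOfFinrankEq ℂ V hV
  refine ⟨D.S (b 0) (b 1), fun x y => ?_⟩
  rw [← b.sum_repr x, ← b.sum_repr y]
  simp only [Fin.sum_univ_two, map_add, map_smul, LinearMap.add_apply, LinearMap.smul_apply,
    D.S_self, D.S_skew (b 1) (b 0)]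
  refine Submodule.mem_span_singleton.2 ⟨b.repr x 0 * b.repr y 1 - b.repr x 1 * b.repr y 0, ?_⟩
  module

theorem isSolvable_rangeM (hV : Module.finrank ℂ V = 2) : LieAlgebra.IsSolvable D.rangeM := by
  obtain ⟨s, hs⟩ := D.exists_S_mem_span hV
  refine isSolvable_of_forall_lie_mem_span (K := ℂ) ⟨D.M s, s, rfl⟩ ?_
  rintro ⟨_, x, rfl⟩ ⟨_, y, rfl⟩
  obtain ⟨c, hc⟩ := Submodule.mem_span_singleton.1 (hs x y)
  refine Submodule.mem_span_singleton.2 ⟨conj c, Subtype.ext <| LinearMap.ext fun t => ?_⟩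
  change conj c • D.M s t = D.M x (D.M y t) - D.M y (D.M x t)
  rw [D.M_commutator, ← hc, map_smulₛₗ, LinearMap.smul_apply]

theorem exists_eigenvector (hV : Module.finrank ℂ V = 2) :
    ∃ w ≠ 0, ∀ x, ∃ c : ℂ, D.M x w = c • w := by
  have : FiniteDimensional ℂ V := Module.finite_of_finrank_eq_succ hV
  have : Nontrivial V := Module.nontrivial_of_finrank_eq_succ hV
  have : LieAlgebra.IsSolvable D.rangeM := D.isSolvable_rangeM hV
  obtain ⟨χ, hχ⟩ := LieModule.exists_nontrivial_weightSpace_of_isSolvable ℂ D.rangeM V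
  obtain ⟨⟨w, hw⟩, hw₀⟩ := exists_ne (0 : LieModule.weightSpace V χ)
  refine ⟨w, by simpa using hw₀, fun x => ⟨χ ⟨D.M x, x, rfl⟩, ?_⟩⟩
  exact (LieModule.mem_weightSpace (M := V) (χ := χ) (m := w)).1 hw ⟨D.M x, x, rfl⟩

end HolomorphicSplitting

section Hermitian

open Complex ComplexConjugate

variable {V : Type*} [LieRing V] [LieAlgebra ℝ V] [Module ℂ V]

/-- A nondegenerate, possibly indefinite hermitian form with respect to which the sesquilinear
part of the bracket determines the complex bilinear part by `map_S`. This is what a symplectic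
form compatible with `I` amounts to. -/
structure HolomorphicSplitting.IsKahler (D : HolomorphicSplitting V) (h : V →ₗ⋆[ℂ] V →ₗ[ℂ] ℂ) :
    Prop where
  symm : h.IsSymm
  separatingLeft : h.SeparatingLeft
  map_S : ∀ x y z, h (D.S x y) z = h x (D.M y z) - h y (D.M x z)

variable [IsScalarTower ℝ ℂ V] {ω : LinearMap.BilinForm ℝ V}

section

variable (hω : ω ∈ compatibleSymplectic (mulI V))
include hω

theorem apply_I_smul_right (x y : V) : ω x (I • y) = -ω (I • x) y := by
  have h := hω.2 x (I • y)
  rw [mulI_apply, mulI_apply, I_smul_I_smul, map_neg] at h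
  exact h.symm

theorem apply_bilinearPart (hI : IsComplexStructure (mulI V)) (x y z : V) :
    ω (bilinearPart V x y) z = ω x (sesquilinearPart V y z) - ω y (sesquilinearPart V x z) := by
  have hcl (x y z : V) : ω ⁅x, y⁆ z = ω x ⁅y, z⁆ - ω y ⁅x, z⁆ := by
    have h := hω.1.2.1 x y z
    rw [← lie_skew z x, ← LinearMap.IsAlt.neg hω.1.1 x, ← LinearMap.IsAlt.neg hω.1.1 y,
      map_neg] at h
    linear_combination h
  have h₁ := hcl x y z
  have h₂ := hcl (I • x) (I • y) z
  have h₃ := apply_I_smul_right hω ⁅I • x, y⁆ z ▸ hcl (I • x) y (I • z)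
  have h₄ := apply_I_smul_right hω ⁅x, I • y⁆ z ▸ hcl x (I • y) (I • z)
  have hN := congrArg (ω · z) (isComplexStructure_mulI_iff.1 hI x y)
  simp only [map_sub, LinearMap.sub_apply, map_zero, LinearMap.zero_apply] at hN
  rw [bilinearPart_apply, sesquilinearPart_apply, sesquilinearPart_apply]
  simp only [map_smul, map_sub, map_add, LinearMap.smul_apply, LinearMap.sub_apply, smul_eq_mul,
    apply_I_smul_right hω]
  linear_combination (1 / 4 : ℝ) * (h₁ - h₂ + h₃ + h₄ - hN)

end

/-- The pseudo-hermitian form with imaginary part `ω`. -/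
noncomputable def hermitianForm (hω : ω ∈ compatibleSymplectic (mulI V)) :
    V →ₗ⋆[ℂ] V →ₗ[ℂ] ℂ :=
  complexSesquilinear
    ((ω.compl₂ (mulI V)).compr₂ (Algebra.linearMap ℝ ℂ) +
      ω.compr₂ (I • Algebra.linearMap ℝ ℂ))
    (fun x y => by
      change (ω (I • x) (I • y) : ℂ) + I * ω (I • x) y = -(I * (ω x (I • y) + I * ω x y))
      rw [apply_I_smul_right hω, apply_I_smul_right hω, I_smul_I_smul, map_neg,
        LinearMap.neg_apply]
      push_cast
      linear_combination (ω x y : ℂ) * I_sq)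
    (fun x y => by
      change (ω x (I • I • y) : ℂ) + I * ω x (I • y) = I * (ω x (I • y) + I * ω x y)
      rw [I_smul_I_smul, map_neg]
      push_cast
      linear_combination -(ω x y : ℂ) * I_sq)

theorem hermitianForm_apply (hω : ω ∈ compatibleSymplectic (mulI V)) (x y : V) :
    hermitianForm hω x y = ω x (I • y) + I * ω x y := rfl

theorem isKahler_hermitianForm (hI : IsComplexStructure (mulI V))
    (hω : ω ∈ compatibleSymplectic (mulI V)) : hI.splitting.IsKahler (hermitianForm hω) where
  symm := ⟨fun x y => by
    rw [hermitianForm_apply, hermitianForm_apply, apply_I_smul_right hω y,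
      LinearMap.IsAlt.neg hω.1.1 (I • y), ← LinearMap.IsAlt.neg hω.1.1 x]
    simp⟩
  separatingLeft x hx := hω.1.2.2 x fun y => by
    simpa [hermitianForm_apply] using congrArg im (hx y)
  map_S x y z := by
    have hS (z : V) : ω (hI.splitting.S x y) z =
        ω x (hI.splitting.M y z) - ω y (hI.splitting.M x z) := apply_bilinearPart hω hI x y z
    simp only [hermitianForm_apply, hS, map_smul]
    push_cast
    ring

end Hermitian

section StructureConstants

open Complex ComplexConjugate Matrix Module

/-- The isomorphism of Lie algebras which maps a basis to another one with the same
structure constants. -/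
noncomputable def lieEquivOfBasis {ι R L L' : Type*} [LinearOrder ι] [CommRing R] [LieRing L]
    [LieAlgebra R L] [LieRing L'] [LieAlgebra R L'] (b : Basis ι R L) (b' : Basis ι R L')
    (h : ∀ i j, i < j → b.equiv b' (Equiv.refl ι) ⁅b i, b j⁆ = ⁅b' i, b' j⁆) : L ≃ₗ⁅R⁆ L' where
  __ := b.equiv b' (Equiv.refl ι)
  map_lie' {x y} := by
    let ψ := b.equiv b' (Equiv.refl ι)
    have hψ (i) : ψ (b i) = b' i := b.equiv_apply ..
    suffices (lieBilinear R L).compr₂ ψ = (lieBilinear R L').compl₁₂ (ψ : L →ₗ[R] L') ψ from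
      LinearMap.congr_fun₂ this x y
    refine b.ext fun i => b.ext fun j => ?_
    change ψ ⁅b i, b j⁆ = ⁅ψ (b i), ψ (b j)⁆
    rw [hψ, hψ]
    rcases lt_trichotomy i j with hij | rfl | hij
    · exact h i j hij
    · rw [lie_self, lie_self, map_zero]
    · rw [← lie_skew, map_neg, h j i hij, lie_skew]

/-- The bracket on `ℂ²` for which `M i` is the matrix, with respect to row vectors, of the
antilinear-linear part of the bracket with the `i`-th basis vector, and `s` is the value of the
complex bilinear part on the two basis vectors. -/
noncomputable def structureBracket (M : Fin 2 → Matrix (Fin 2) (Fin 2) ℂ) (s x y : Fin 2 → ℂ) :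
    Fin 2 → ℂ :=
  (x 0 * y 1 - x 1 * y 0) • s + y ᵥ* (∑ i, conj (x i) • M i) - x ᵥ* (∑ i, conj (y i) • M i)

variable {V : Type*} [LieRing V] [LieAlgebra ℝ V] [Module ℂ V]
  {D : HolomorphicSplitting V} {M : Fin 2 → Matrix (Fin 2) (Fin 2) ℂ} {s : Fin 2 → ℂ}

namespace HolomorphicSplitting

/-- In some complex basis the splitting is given by the matrices `M 0`, `M 1`, which act on row
vectors, and by the vector `s`. -/
def HasStructureConstants (D : HolomorphicSplitting V) (M : Fin 2 → Matrix (Fin 2) (Fin 2) ℂ)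
    (s : Fin 2 → ℂ) : Prop :=
  ∃ b : Basis (Fin 2) ℂ V, (∀ i j, D.M (b i) (b j) = ∑ k, M i j k • b k) ∧
    D.S (b 0) (b 1) = ∑ k, s k • b k

namespace HasStructureConstants

theorem change (H : D.HasStructureConstants M s) {N : Fin 2 → Matrix (Fin 2) (Fin 2) ℂ}
    {t : Fin 2 → ℂ} (g : Matrix (Fin 2) (Fin 2) ℂ) (hg : g.det ≠ 0)
    (hM : ∀ i, g * (∑ j, conj (g i j) • M j) = N i * g) (hs : g.det • s = t ᵥ* g) :
    D.HasStructureConstants N t := by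
  obtain ⟨b, hbM, hbS⟩ := H
  let b' : Basis (Fin 2) ℂ V := b.map (toLinearEquiv b gᵀ (by simpa using hg))
  have hb' (i) : b' i = g i 0 • b 0 + g i 1 • b 1 := by
    simp [b', toLin_self, Fin.sum_univ_two]
  refine ⟨b', fun i j => ?_, ?_⟩
  · calc
      D.M (b' i) (b' j) = ∑ k, (g * (∑ j, conj (g i j) • M j)) j k • b k := by
        simp only [hb', map_add, map_smulₛₗ, LinearMap.add_apply, LinearMap.smul_apply, hbM,
          Matrix.mul_apply, Fin.sum_univ_two, Matrix.add_apply, Matrix.smul_apply,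
          RingHom.id_apply, smul_eq_mul]
        module
      _ = ∑ k, N i j k • b' k := by
        rw [hM]
        simp only [hb', Matrix.mul_apply, Fin.sum_univ_two]
        module
  · calc
      D.S (b' 0) (b' 1) = ∑ k, (g.det • s) k • b k := by
        simp only [hb', map_add, map_smul, LinearMap.add_apply, LinearMap.smul_apply, D.S_self,
          D.S_skew (b 1) (b 0), hbS, det_fin_two, Fin.sum_univ_two, Pi.smul_apply, smul_eq_mul]
        module
      _ = ∑ k, t k • b' k := by
        rw [hs]
        simp only [hb', vecMul_eq_sum, Fin.sum_univ_two, Pi.add_apply, Pi.smul_apply,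
          smul_eq_mul]
        module

theorem exists_lie_eq (H : D.HasStructureConstants M s) : ∃ φ : V ≃ₗ[ℂ] (Fin 2 → ℂ),
    ∀ x y, ⁅x, y⁆ = φ.symm (structureBracket M s (φ x) (φ y)) := by
  obtain ⟨b, hbM, hbS⟩ := H
  refine ⟨b.equivFun, fun x y => ?_⟩
  conv_lhs => rw [← b.sum_equivFun x, ← b.sum_equivFun y]
  simp only [D.lie_eq, Fin.sum_univ_two, map_add, map_smulₛₗ, LinearMap.add_apply,
    LinearMap.smul_apply, RingHom.id_apply, D.S_self, D.S_skew (b 1) (b 0), hbM, hbS,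
    Basis.equivFun_symm_apply, structureBracket, vecMul_eq_sum, Pi.add_apply, Pi.sub_apply,
    Pi.smul_apply, Matrix.add_apply, Matrix.smul_apply, smul_eq_mul]
  module

theorem isLieAbelian (H : D.HasStructureConstants 0 0) : IsLieAbelian V := by
  obtain ⟨φ, hφ⟩ := H.exists_lie_eq
  exact ⟨fun x y => by simp [hφ, structureBracket]⟩

theorem jacobi_M (H : D.HasStructureConstants M s) :
    M 1 * M 0 - M 0 * M 1 = ∑ i, conj (s i) • M i := by
  obtain ⟨b, hbM, hbS⟩ := H
  ext j k
  have h := congrArg (b.equivFun · k) (D.M_commutator (b 0) (b 1) (b j))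
  fin_cases k <;> simpa [hbM, hbS, Matrix.mul_apply, Fin.sum_univ_two] using h

theorem jacobi_S (H : D.HasStructureConstants M s) (i : Fin 2) :
    s ᵥ* M i = (M i).trace • s + ∑ j, conj (M 1 i j) • M j 0 - ∑ j, conj (M 0 i j) • M j 1 := by
  obtain ⟨b, hbM, hbS⟩ := H
  ext k
  have h := congrArg (b.equivFun · k) (D.M_S (b 0) (b 1) (b i))
  fin_cases k <;>
  · simp [hbM, hbS, D.S_self, trace_fin_two, vecMul_eq_sum, Fin.sum_univ_two] at h ⊢
    linear_combination h

end HasStructureConstants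

end HolomorphicSplitting

end StructureConstants

section NormalForms

open Complex ComplexConjugate Matrix Module

theorem structureBracket_apply (M : Fin 2 → Matrix (Fin 2) (Fin 2) ℂ) (s x y : Fin 2 → ℂ)
    (k : Fin 2) : structureBracket M s x y k = (x 0 * y 1 - x 1 * y 0) * s k +
      ∑ i, ∑ j, (conj (x i) * y j - conj (y i) * x j) * M i j k := by
  simp only [structureBracket, vecMul_eq_sum, Fin.sum_univ_two, Pi.add_apply, Pi.sub_apply,
    Pi.smul_apply, Matrix.add_apply, Matrix.smul_apply, smul_eq_mul]
  ring

/-- `V`, with the complex structure `x ↦ I • x`, is isomorphic to a line of the table. -/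
def InKahlerTable (V : Type*) [LieRing V] [LieAlgebra ℝ V] [Module ℂ V] : Prop :=
  ∃ (A : LieName) (J₀ : A.Alg →ₗ[ℝ] A.Alg) (S : Set (LinearMap.BilinForm ℝ A.Alg))
    (φ : V ≃ₗ⁅ℝ⁆ A.Alg), KahlerTable A J₀ S ∧ ∀ x, φ (I • x) = J₀ (φ x)

/-- The vectors `P 0, …, P 3` of `ℂ²`, with the bracket given by `M` and `s`, satisfy the same
relations as the basis `e₁, …, e₄` of `A` with the complex structure `J₀`. -/
structure IsRealization (A : LieName) (J₀ : A.Alg →ₗ[ℝ] A.Alg) (P : Fin 4 → Fin 2 → ℂ)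
    (M : Fin 2 → Matrix (Fin 2) (Fin 2) ℂ) (s : Fin 2 → ℂ) : Prop where
  linearIndependent : LinearIndependent ℝ P
  I_smul : ∀ i, I • P i = ∑ k, J₀ (A.e i) k • P k
  bracket_eq : ∀ i j, i < j →
    structureBracket M s (P i) (P j) = ∑ k, (⁅A.e i, A.e j⁆ : A.Alg) k • P k

variable {V : Type*} [LieRing V] [LieAlgebra ℝ V] [Module ℂ V] [IsScalarTower ℝ ℂ V]
  {D : HolomorphicSplitting V} {M : Fin 2 → Matrix (Fin 2) (Fin 2) ℂ} {s : Fin 2 → ℂ}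

theorem HolomorphicSplitting.HasStructureConstants.inKahlerTable (H : D.HasStructureConstants M s)
    {A : LieName} {J₀ : A.Alg →ₗ[ℝ] A.Alg} {S : Set (LinearMap.BilinForm ℝ A.Alg)}
    (hA : KahlerTable A J₀ S) {P : Fin 4 → Fin 2 → ℂ} (hP : IsRealization A J₀ P M s) :
    InKahlerTable V := by
  obtain ⟨φ, hφ⟩ := H.exists_lie_eq
  let b : Basis (Fin 4) ℝ (Fin 2 → ℂ) := basisOfLinearIndependentOfCardEqFinrank
    hP.linearIndependent (by simp [finrank_pi_fintype, finrank_real_complex])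
  let c : Basis (Fin 4) ℝ V := b.map (φ.restrictScalars ℝ).symm
  have hc (i) : c i = φ.symm (P i) := by simp [c, b]
  have hsum (x : A.Alg) : A.basis.equiv c (Equiv.refl _) x = φ.symm (∑ k, x k • P k) := by
    conv_lhs => rw [← A.basis.sum_repr x]
    simp only [map_sum, map_smul, Basis.equiv_apply, Equiv.refl_apply, hc]
    exact Finset.sum_congr rfl fun k _ => ((φ.symm.restrictScalars ℝ).map_smul (x k) (P k)).symm
  obtain ⟨ψ, hψ⟩ : ∃ ψ : A.Alg ≃ₗ⁅ℝ⁆ V, ∀ x, ψ x = φ.symm (∑ k, x k • P k) :=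
    ⟨lieEquivOfBasis A.basis c fun i j hij => by
      rw [hc, hc, hφ, φ.apply_symm_apply, φ.apply_symm_apply, hP.bracket_eq i j hij]
      exact hsum ⁅A.e i, A.e j⁆, hsum⟩
  have hJ : (ψ : A.Alg →ₗ[ℝ] V) ∘ₗ J₀ = mulI V ∘ₗ (ψ : A.Alg →ₗ[ℝ] V) := A.basis.ext fun i => by
    have hi : ψ (A.e i) = φ.symm (P i) := by simp [hψ, LieName.e_apply, ite_smul]
    have hi' : ψ (J₀ (A.e i)) = I • ψ (A.e i) := by rw [hψ, ← hP.I_smul, map_smul, hi]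
    exact hi'
  replace hJ (x : A.Alg) : ψ (J₀ x) = I • ψ x := LinearMap.congr_fun hJ x
  refine ⟨A, J₀, S, ψ.symm, hA, fun x => ψ.injective ?_⟩
  have hx (y : V) : ψ (ψ.symm y) = y := ψ.apply_symm_apply y
  exact (hx _).trans ((hJ _).trans (congrArg (I • ·) (hx x))).symm

/-- The structure constants of the lines of the table, with respect to a suitable complex
basis. -/
inductive NormalForm : (Fin 2 → Matrix (Fin 2) (Fin 2) ℂ) → (Fin 2 → ℂ) → Prop
  | rh3 : NormalForm ![!![0, -I / 2; 0, 0], 0] 0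
  | rr30 : NormalForm ![!![1 / 2, 0; 0, 0], 0] 0
  | rr30' : NormalForm ![!![0, 0; 0, -I / 2], 0] ![0, -I / 2]
  | r2r2 : NormalForm ![!![1 / 2, 0; 0, 0], !![0, 0; 0, 1 / 2]] 0
  | r2'_J1 : NormalForm ![!![1 / 2, 0; 0, 1 / 2], !![0, 1 / 2; -1 / 2, 0]] 0
  | r2'_J2 : NormalForm ![!![0, 0; 0, 1], 0] 0
  | r4 : NormalForm ![!![1 / 2, 0; 0, -1 / 2], 0] ![0, -1 / 2]
  | r4'_J1 (δ : ℝ) (hδ : 0 < δ) : NormalForm ![!![1 / 2, 0; 0, -I * δ / 2], 0] ![0, -I * δ / 2]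
  | r4'_J2 (δ : ℝ) (hδ : 0 < δ) : NormalForm ![!![1 / 2, 0; 0, I * δ / 2], 0] ![0, I * δ / 2]
  | d41 : NormalForm ![!![1 / 2, 0; 0, 1 / 2], !![0, 1 / 2; 0, 0]] 0
  | d42_J1 : NormalForm ![!![-1 / 2, 0; 0, 1 / 2], !![0, -1 / 2; 0, 0]] ![0, 1]
  | d42_J2 : NormalForm ![!![1, 0; 0, 1 / 2], !![0, 1; 0, 0]] ![0, -1 / 2]
  | d4half_J1 : NormalForm ![!![1 / 2, 0; 0, 1 / 4], !![0, 0; 1 / 2, 0]] ![0, 1 / 4]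
  | d4half_J2 : NormalForm ![!![1 / 2, 0; 0, 1 / 4], !![0, 0; -1 / 2, 0]] ![0, 1 / 4]
  | d4'_J1 (δ : ℝ) (hδ : 0 < δ) :
      NormalForm ![!![δ / 2, 0; 0, δ / 4 - I / 2], !![0, 0; 1 / 2, 0]] ![0, δ / 4 - I / 2]
  | d4'_J2 (δ : ℝ) (hδ : 0 < δ) :
      NormalForm ![!![δ / 2, 0; 0, δ / 4 - I / 2], !![0, 0; -1 / 2, 0]] ![0, δ / 4 - I / 2]
  | d4'_J3 (δ : ℝ) (hδ : 0 < δ) :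
      NormalForm ![!![δ / 2, 0; 0, δ / 4 + I / 2], !![0, 0; 1 / 2, 0]] ![0, δ / 4 + I / 2]
  | d4'_J4 (δ : ℝ) (hδ : 0 < δ) :
      NormalForm ![!![δ / 2, 0; 0, δ / 4 + I / 2], !![0, 0; -1 / 2, 0]] ![0, δ / 4 + I / 2]

set_option maxHeartbeats 2000000 in
theorem NormalForm.exists_isRealization (h : NormalForm M s) :
    ∃ A J₀ S P, KahlerTable A J₀ S ∧ IsRealization A J₀ P M s := by
  cases h
  case' rh3 => refine ⟨_, _, _, ![![1, 0], ![I, 0], ![0, 1], ![0, I]], .rh3, ?_⟩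
  case' rr30 => refine ⟨_, _, _, ![![1, 0], ![I, 0], ![0, 1], ![0, I]], .rr30, ?_⟩
  case' rr30' => refine ⟨_, _, _, ![![1, 0], ![0, 1], ![0, I], ![I, 0]], .rr30', ?_⟩
  case' r2r2 => refine ⟨_, _, _, ![![1, 0], ![I, 0], ![0, 1], ![0, I]], .r2r2, ?_⟩
  case' r2'_J1 => refine ⟨_, _, _, ![![1, 0], ![0, 1], ![I, 0], ![0, I]], .r2'_J1, ?_⟩
  case' r2'_J2 => refine ⟨_, _, _, ![![1, 0], ![-I, 0], ![0, 1], ![0, I]], .r2'_J2, ?_⟩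
  case' r4 => refine ⟨_, _, _, ![![I, 0], ![0, 1], ![0, I], ![1, 0]], .r4, ?_⟩
  case' r4'_J1 δ hδ => refine ⟨_, _, _, ![![I, 0], ![0, 1], ![0, I], ![1, 0]], .r4'_J1 δ hδ, ?_⟩
  case' r4'_J2 δ hδ => refine ⟨_, _, _, ![![I, 0], ![0, 1], ![0, -I], ![1, 0]], .r4'_J2 δ hδ, ?_⟩
  case' d41 => refine ⟨_, _, _, ![![-I, 0], ![0, 1], ![0, I], ![1, 0]], .d41, ?_⟩
  case' d42_J1 => refine ⟨_, _, _, ![![0, 1], ![-I, 0], ![0, I], ![1, 0]], .d42_J1, ?_⟩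
  case' d42_J2 => refine ⟨_, _, _, ![![-I / 2, 0], ![0, 1], ![0, I], ![1, 0]], .d42_J2, ?_⟩
  case' d4half_J1 => refine ⟨_, _, _, ![![0, 1], ![0, I], ![I, 0], ![1, 0]], .d4half_J1, ?_⟩
  case' d4half_J2 => refine ⟨_, _, _, ![![0, 1], ![0, -I], ![I, 0], ![1, 0]], .d4half_J2, ?_⟩
  case' d4'_J1 δ hδ => refine ⟨_, _, _, ![![0, 1], ![0, I], ![I, 0], ![1, 0]], .d4'_J1 δ hδ, ?_⟩
  case' d4'_J2 δ hδ => refine ⟨_, _, _, ![![0, 1], ![0, I], ![-I, 0], ![1, 0]], .d4'_J2 δ hδ, ?_⟩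
  case' d4'_J3 δ hδ => refine ⟨_, _, _, ![![0, 1], ![0, -I], ![-I, 0], ![1, 0]], .d4'_J3 δ hδ, ?_⟩
  case' d4'_J4 δ hδ => refine ⟨_, _, _, ![![0, 1], ![0, -I], ![I, 0], ![1, 0]], .d4'_J4 δ hδ, ?_⟩
  all_goals
    refine ⟨Fintype.linearIndependent_iff.2 fun g hg => ?_, fun i => ?_, fun i j hij => ?_⟩
    · simp [Fin.sum_univ_four, funext_iff, Complex.ext_iff] at hg
      simp [Fin.forall_fin_succ, hg]
    · fin_cases i <;>
        simp [LieName.endo_apply, LieName.neg_apply, LieName.smul_apply, LieName.e_apply,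
          Complex.ext_iff] <;>
        norm_num
    · ext k
      fin_cases k <;> fin_cases i <;> fin_cases j <;> simp at hij <;>
        simp [structureBracket_apply, Fin.sum_univ_two, Fin.sum_univ_four, LieName.lie_apply,
          LieName.bracket, LieName.e_apply, Complex.ext_iff, conj_ofNat] <;>
        (try constructor) <;> ring

theorem NormalForm.inKahlerTable {N : Fin 2 → Matrix (Fin 2) (Fin 2) ℂ} {t : Fin 2 → ℂ}
    (hN : NormalForm N t) (H : D.HasStructureConstants M s) (g : Matrix (Fin 2) (Fin 2) ℂ)
    (hg : g.det ≠ 0) (hM : ∀ i, g * (∑ j, conj (g i j) • M j) = N i * g)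
    (hs : g.det • s = t ᵥ* g) : InKahlerTable V := by
  obtain ⟨_, _, _, _, hA, hP⟩ := hN.exists_isRealization
  exact (H.change g hg hM hs).inKahlerTable hA hP

end NormalForms

section Families

open Complex ComplexConjugate Matrix

variable {V : Type*} [LieRing V] [LieAlgebra ℝ V] [Module ℂ V] [IsScalarTower ℝ ℂ V]
  {D : HolomorphicSplitting V}

theorem conj_ne_zero {z : ℂ} (hz : z ≠ 0) : conj z ≠ 0 := (map_ne_zero _).2 hz

theorem exists_real_of_conj_add {b f : ℂ} (hf : f ≠ 0) (h : conj f * b + f * conj b = 0) :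
    ∃ τ : ℝ, b = I * τ * f := by
  have hf' := conj_ne_zero hf
  have hconj : conj (-I * (b / f)) = -I * (b / f) := by
    simp only [map_mul, map_neg, conj_I, map_div₀]
    field_simp
    linear_combination h
  obtain ⟨τ, hτ⟩ := conj_eq_iff_real.1 hconj
  refine ⟨τ, ?_⟩
  rw [← hτ]
  field_simp
  linear_combination b * I_sq

theorem NormalForm.exists_hyperbolic (τ : ℝ) {u : ℂ} (hu : u = 1 / 2 ∨ u = -1 / 2) :
    ∃ z : ℝ, 0 < z ∧ NormalForm ![!![(z : ℂ), 0; 0, z * (1 / 2 - I * τ)], !![0, 0; u, 0]]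
      ![0, z * (1 / 2 - I * τ)] := by
  rcases lt_trichotomy τ 0 with hτ | rfl | hτ
  · have hδ : 0 < -1 / τ := div_pos_of_neg_of_neg (by norm_num) hτ
    have hτ₀ : (τ : ℂ) ≠ 0 := ofReal_ne_zero.2 hτ.ne
    have hz : ((-1 / τ / 2 : ℝ) : ℂ) = (-1 / τ : ℝ) / 2 := by push_cast; rfl
    have hs : ((-1 / τ / 2 : ℝ) : ℂ) * (1 / 2 - I * τ) = ((-1 / τ : ℝ) : ℂ) / 4 + I / 2 := by
      push_cast
      field_simp
      ring
    refine ⟨-1 / τ / 2, half_pos hδ, ?_⟩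
    rw [hs, hz]
    rcases hu with rfl | rfl
    exacts [.d4'_J3 _ hδ, .d4'_J4 _ hδ]
  · have hz : ((1 / 2 : ℝ) : ℂ) = 1 / 2 := by push_cast; rfl
    have hs : ((1 / 2 : ℝ) : ℂ) * (1 / 2 - I * (0 : ℝ)) = 1 / 4 := by
      push_cast
      ring
    refine ⟨1 / 2, one_half_pos, ?_⟩
    rw [hs, hz]
    rcases hu with rfl | rfl
    exacts [.d4half_J1, .d4half_J2]
  · have hδ : 0 < 1 / τ := one_div_pos.2 hτ
    have hτ₀ : (τ : ℂ) ≠ 0 := ofReal_ne_zero.2 hτ.ne'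
    have hz : ((1 / τ / 2 : ℝ) : ℂ) = (1 / τ : ℝ) / 2 := by push_cast; rfl
    have hs : ((1 / τ / 2 : ℝ) : ℂ) * (1 / 2 - I * τ) = ((1 / τ : ℝ) : ℂ) / 4 - I / 2 := by
      push_cast
      field_simp
      ring
    refine ⟨1 / τ / 2, half_pos hδ, ?_⟩
    rw [hs, hz]
    rcases hu with rfl | rfl
    exacts [.d4'_J1 _ hδ, .d4'_J2 _ hδ]

namespace HolomorphicSplitting.HasStructureConstants

theorem inKahlerTable_product {a f : ℂ}
    (H : D.HasStructureConstants ![!![-conj a, 0; 0, 0], !![0, 0; 0, -conj f]] 0)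
    (h : a ≠ 0 ∨ f ≠ 0) : InKahlerTable V := by
  by_cases ha : a = 0
  · have hf : f ≠ 0 := h.resolve_left (not_not.2 ha)
    have hf' := conj_ne_zero hf
    refine NormalForm.rr30.inKahlerTable H !![0, -1 / (2 * f); 1, 0] ?_ ?_ ?_ <;>
      simp [← Matrix.ext_iff, Fin.forall_fin_two, Fin.sum_univ_two, conj_ofNat, ha, hf]
    field_simp
  · have ha' := conj_ne_zero ha
    by_cases hf : f = 0
    · refine NormalForm.rr30.inKahlerTable H !![-1 / (2 * a), 0; 0, 1] ?_ ?_ ?_ <;>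
        simp [← Matrix.ext_iff, Fin.forall_fin_two, Fin.sum_univ_two, conj_ofNat, ha, hf]
      field_simp
    · have hf' := conj_ne_zero hf
      refine NormalForm.r2r2.inKahlerTable H !![-1 / (2 * a), 0; 0, -1 / (2 * f)] ?_ ?_ ?_ <;>
        simp [← Matrix.ext_iff, Fin.forall_fin_two, Fin.sum_univ_two, conj_ofNat, ha, hf]
      constructor <;> field_simp

theorem inKahlerTable_rotation {b f : ℂ}
    (H : D.HasStructureConstants ![!![-conj f, 0; 0, -conj b], 0] ![0, b]) (hb : b ≠ 0)
    (h : conj f * b + f * conj b = 0) : InKahlerTable V := by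
  have hb' := conj_ne_zero hb
  by_cases hf : f = 0
  · refine NormalForm.rr30'.inKahlerTable H !![-I / (2 * b), 0; 0, 1] ?_ ?_ ?_ <;>
      simp [← Matrix.ext_iff, Fin.forall_fin_two, Fin.sum_univ_two, conj_ofNat, hb, hf] <;>
      field_simp
  · have hf' := conj_ne_zero hf
    obtain ⟨τ, rfl⟩ := exists_real_of_conj_add hf h
    have hτ : τ ≠ 0 := fun h0 => hb (by simp [h0])
    rcases hτ.lt_or_gt with hneg | hpos
    · refine (NormalForm.r4'_J2 _ (neg_pos.2 hneg)).inKahlerTable H !![-1 / (2 * f), 0; 0, 1]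
        ?_ ?_ ?_ <;>
        simp [← Matrix.ext_iff, Fin.forall_fin_two, Fin.sum_univ_two, conj_ofNat, hf] <;>
        field_simp
      simp
    · refine (NormalForm.r4'_J1 _ hpos).inKahlerTable H !![-1 / (2 * f), 0; 0, 1] ?_ ?_ ?_ <;>
        simp [← Matrix.ext_iff, Fin.forall_fin_two, Fin.sum_univ_two, conj_ofNat, hf] <;>
        field_simp
      simp

theorem inKahlerTable_of_smul_hyperbolic {f u : ℂ} {ε τ z : ℝ}
    (H : D.HasStructureConstants ![!![-conj f, 0; 0, -conj ((1 / 2 + I * τ) * f)],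
      !![0, 0; -ε * conj f, 0]] ![0, (1 / 2 + I * τ) * f - f]) (hf : f ≠ 0) (hε : ε ≠ 0)
    (hz : 0 < z) (hu : 2 * |ε| * u = ε)
    (hN : NormalForm ![!![(z : ℂ), 0; 0, z * (1 / 2 - I * τ)], !![0, 0; u, 0]]
      ![0, z * (1 / 2 - I * τ)]) : InKahlerTable V := by
  have hf' := conj_ne_zero hf
  have hz' : (z : ℂ) ≠ 0 := ofReal_ne_zero.2 hz.ne'
  have hpos : 0 < z / (2 * |ε| * normSq f) := by
    have := normSq_pos.2 hf
    positivity
  obtain ⟨r, hr, hr'⟩ : ∃ r : ℝ, r ≠ 0 ∧ (r : ℂ) * r * (2 * |ε| * (f * conj f)) = z := by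
    refine ⟨√(z / (2 * |ε| * normSq f)), (Real.sqrt_pos.2 hpos).ne', ?_⟩
    have := normSq_pos.2 hf
    rw [mul_conj]
    norm_cast
    rw [Real.mul_self_sqrt hpos.le]
    field_simp
  have hzu : u * z = r ^ 2 * ε * conj f * f := by
    linear_combination -u * hr' + r * r * f * conj f * hu
  refine hN.inKahlerTable H !![-z / f, 0; 0, r] ?_ ?_ ?_ <;>
    simp [← Matrix.ext_iff, Fin.forall_fin_two, Fin.sum_univ_two, conj_ofNat, hf, hz', hr] <;>
    (try constructorm* _ ∧ _) <;> field_simp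
  · ring
  · simp [hzu]
  · ring

theorem inKahlerTable_hyperbolic {b f : ℂ} {ε : ℝ}
    (H : D.HasStructureConstants ![!![-conj f, 0; 0, -conj b], !![0, 0; -ε * conj f, 0]]
      ![0, b - f]) (hf : f ≠ 0) (hε : ε ≠ 0) (h : f * conj f = b * conj f + f * conj b) :
    InKahlerTable V := by
  obtain ⟨τ, hτ⟩ := exists_real_of_conj_add (b := b - f / 2) hf (by
    simp only [map_sub, map_div₀, conj_ofNat]
    linear_combination -h)
  obtain rfl : b = (1 / 2 + I * τ) * f := by linear_combination hτ
  obtain ⟨u, hu, hεu⟩ : ∃ u : ℂ, (u = 1 / 2 ∨ u = -1 / 2) ∧ 2 * |ε| * u = ε := by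
    rcases hε.lt_or_gt with hε | hε
    · refine ⟨-1 / 2, .inr rfl, ?_⟩
      rw [abs_of_neg hε]
      push_cast
      ring
    · refine ⟨1 / 2, .inl rfl, ?_⟩
      rw [abs_of_pos hε]
      ring
  obtain ⟨z, hz, hN⟩ := NormalForm.exists_hyperbolic τ hu
  exact H.inKahlerTable_of_smul_hyperbolic hf hε hz hεu hN

theorem inKahlerTable_d42 {d u : ℂ}
    (H : D.HasStructureConstants ![!![-2 * conj d, 0; 0, -conj d], !![0, -conj u; 0, 0]] ![0, d])
    (hd : d ≠ 0) (h : u * conj u = 4 * (d * conj d)) : InKahlerTable V := by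
  have hd' := conj_ne_zero hd
  obtain ⟨ρ, hρ, hρ'⟩ : ∃ ρ : ℂ, ρ ≠ 0 ∧ conj ρ * conj u = 2 * ρ * d := by
    by_cases hud : 2 * d + conj u = 0
    · refine ⟨I, I_ne_zero, ?_⟩
      simp only [conj_I]
      linear_combination -I * hud
    · refine ⟨(2 * d + conj u) / (2 * d), div_ne_zero hud (by simpa using hd), ?_⟩
      simp only [map_div₀, map_add, map_mul, conj_ofNat, conj_conj]
      field_simp
      linear_combination h
  refine NormalForm.d42_J2.inKahlerTable H !![-1 / (2 * d), 0; 0, ρ] ?_ ?_ ?_ <;>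
    simp [← Matrix.ext_iff, Fin.forall_fin_two, Fin.sum_univ_two, conj_ofNat, hd, hρ] <;>
    field_simp
  simpa [mul_right_comm ρ, mul_comm ρ] using hρ'

end HolomorphicSplitting.HasStructureConstants

end Families

section NullFrames

open Complex ComplexConjugate Matrix

variable {V : Type*} [LieRing V] [LieAlgebra ℝ V] [Module ℂ V] {D : HolomorphicSplitting V}
  {a b c d e f : ℂ}

/-- The matrices of structure constants in a basis whose first vector is null and an eigenvector
of all `D.M x`. The compatibility of the metric then forces `D.S` to have the components `c - b`
and `d`. -/
noncomputable def nullMatrices (a b c d e f : ℂ) : Fin 2 → Matrix (Fin 2) (Fin 2) ℂ :=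
  ![!![-conj d, 0; -conj c, -conj a], !![-conj f, 0; -conj e, -conj b]]

theorem nullMatrices_zero : nullMatrices 0 0 0 0 0 0 = 0 := by
  ext i j k
  fin_cases i <;> fin_cases j <;> fin_cases k <;> simp [nullMatrices]

namespace HolomorphicSplitting.HasStructureConstants

theorem null_relations (H : D.HasStructureConstants (nullMatrices a b c d e f) ![c - b, d]) :
    ((c - b) * a + d * b = 0 ∧ c * (c - f) + 2 * d * e - e * a = 0 ∧ d * (c - b + f) = 0) ∧
    d * conj (a + d) = 0 ∧ conj a * (c - b) - f * conj d = 0 ∧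
    conj f * d + c * conj a + a * conj b = 0 ∧
    conj b * (c - b) - b * conj f + c * conj c + a * conj e - d * conj e - e * conj d = 0 := by
  have hM := congrArg (map · conj) H.jacobi_M
  have hS₀ := H.jacobi_S 0
  have hS₁ := H.jacobi_S 1
  simp only [← Matrix.ext_iff, Fin.forall_fin_two, funext_iff] at hM hS₀ hS₁
  simp [nullMatrices, Fin.sum_univ_two, trace_fin_two, vecHead, vecTail] at hM hS₀ hS₁
  obtain ⟨E₃, E₂, E₁⟩ := hM
  obtain ⟨E₅, E₄⟩ := hS₀
  obtain ⟨E₇, E₆⟩ := hS₁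
  rw [map_add]
  refine ⟨⟨?_, ?_, ?_⟩, ?_, ?_, ?_, ?_⟩
  · linear_combination E₁
  · linear_combination E₂
  · linear_combination E₃
  · linear_combination E₄
  · linear_combination E₅
  · linear_combination E₆
  · linear_combination E₇

variable [IsScalarTower ℝ ℂ V]

theorem inKahlerTable_null_of_d_ne_zero
    (H : D.HasStructureConstants (nullMatrices a b c d e f) ![c - b, d]) (hd : d ≠ 0) :
    InKahlerTable V := by
  obtain ⟨⟨E₁, E₂, E₃⟩, E₄, -, E₆, -⟩ := H.null_relations
  have hd' := conj_ne_zero hd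
  obtain rfl : a = -d :=
    eq_neg_of_add_eq_zero_left ((map_eq_zero conj).1 ((mul_eq_zero.1 E₄).resolve_left hd))
  obtain rfl : c = 2 * b := mul_left_cancel₀ hd (by linear_combination -E₁)
  obtain rfl : f = -b := mul_left_cancel₀ hd (by linear_combination E₃)
  have hbd : conj b * d + b * conj d = 0 := by
    simp only [map_neg] at E₆
    linear_combination (-1 / 2) * E₆
  obtain rfl : e = -2 * b ^ 2 / d := by
    field_simp
    linear_combination E₂ / 3
  refine NormalForm.r4.inKahlerTable H !![-1 / (2 * d), 0; b / d, 1] ?_ ?_ ?_ <;>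
    simp [nullMatrices, ← Matrix.ext_iff, Fin.forall_fin_two, Fin.sum_univ_two, conj_ofNat,
      hd] <;>
    constructorm* _ ∧ _ <;> field_simp
  all_goals first | ring1 | linear_combination 2 * hbd

theorem inKahlerTable_null_of_a_ne_zero
    (H : D.HasStructureConstants (nullMatrices a b c 0 e f) ![c - b, 0]) (ha : a ≠ 0) :
    InKahlerTable V := by
  obtain ⟨⟨-, E₂, -⟩, -, E₅, E₆, -⟩ := H.null_relations
  have ha' := conj_ne_zero ha
  obtain rfl : c = b := mul_left_cancel₀ ha' (by simpa [mul_sub, sub_eq_zero] using E₅)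
  have hab : c * conj a + conj c * a = 0 := by linear_combination E₆
  obtain rfl : e = c * (c - f) / a := by
    field_simp
    linear_combination -E₂
  have H' : D.HasStructureConstants ![!![0, 0; 0, -conj a], !![-conj f, 0; 0, 0]] 0 := by
    refine H.change !![1, 0; -c / a, 1] ?_ ?_ ?_ <;>
      simp [nullMatrices, ← Matrix.ext_iff, Fin.forall_fin_two, Fin.sum_univ_two] <;>
      constructorm* _ ∧ _ <;> field_simp
    all_goals first | ring1 | linear_combination hab | linear_combination conj f * hab
  by_cases hf : f = 0
  · refine NormalForm.r2'_J2.inKahlerTable H' !![-1 / a, 0; 0, 1] ?_ ?_ ?_ <;>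
      simp [← Matrix.ext_iff, Fin.forall_fin_two, Fin.sum_univ_two, ha, hf]
  · have hf' := conj_ne_zero hf
    refine NormalForm.r2'_J1.inKahlerTable H'
      !![-1 / (2 * a), -1 / (2 * f); -I / (2 * a), I / (2 * f)] ?_ ?_ ?_
    · rw [det_fin_two_of]
      field_simp
      norm_num [ha, hf]
    · simp [← Matrix.ext_iff, Fin.forall_fin_two, Fin.sum_univ_two, conj_ofNat]
      constructorm* _ ∧ _ <;> field_simp
      all_goals linear_combination -I_sq
    · simp

theorem inKahlerTable_null_of_c_ne_zero
    (H : D.HasStructureConstants (nullMatrices 0 b c 0 e f) ![c - b, 0]) (hc : c ≠ 0) :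
    InKahlerTable V := by
  obtain ⟨⟨-, E₂, -⟩, -, -, -, E₇⟩ := H.null_relations
  obtain rfl : c = f := mul_left_cancel₀ hc (by linear_combination E₂)
  have hc' := conj_ne_zero hc
  have hbc : (b - c) * (b + c) = 0 := by
    have E₇' := congrArg conj E₇
    simp only [map_sub, map_add, map_mul, map_zero, conj_conj] at E₇ E₇'
    refine (mul_eq_zero.1 ?_).resolve_left hc'
    linear_combination (-b / 2 - c / 2) * E₇ + (b / 2 - c / 2) * E₇'
  rcases mul_eq_zero.1 hbc with h | h
  · obtain rfl : b = c := sub_eq_zero.1 h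
    refine NormalForm.d41.inKahlerTable H !![e / (2 * b ^ 2), -1 / (2 * b); conj b, 0]
      ?_ ?_ ?_ <;>
      simp [nullMatrices, ← Matrix.ext_iff, Fin.forall_fin_two, Fin.sum_univ_two, conj_ofNat,
        hc] <;>
      (try constructorm* _ ∧ _) <;> field_simp
    all_goals ring
  · obtain rfl : b = -c := eq_neg_of_add_eq_zero_left h
    refine NormalForm.d42_J1.inKahlerTable H
      !![-1 / (2 * c) * (2 * (-conj e / conj c) + e / c) / 3, -1 / (2 * c); I * conj c, 0]
      ?_ ?_ ?_ <;>
      simp [nullMatrices, ← Matrix.ext_iff, Fin.forall_fin_two, Fin.sum_univ_two, conj_ofNat,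
        hc] <;>
      (try constructorm* _ ∧ _) <;> field_simp
    all_goals ring

theorem inKahlerTable_null_of_matrix_zero_eq_zero
    (H : D.HasStructureConstants (nullMatrices 0 b 0 0 e f) ![0 - b, 0]) (hV : ¬IsLieAbelian V) :
    InKahlerTable V := by
  obtain ⟨-, -, -, -, E₇⟩ := H.null_relations
  by_cases hb : b = 0
  · by_cases hf : f = 0
    · have he : e ≠ 0 := by
        rintro rfl
        have hs : (![0 - b, 0] : Fin 2 → ℂ) = 0 := by simp [hb]
        rw [hs, hb, hf, nullMatrices_zero] at H
        exact hV H.isLieAbelian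
      refine NormalForm.rh3.inKahlerTable H !![0, 1; -2 * I * conj e, 0] ?_ ?_ ?_ <;>
        simp [nullMatrices, ← Matrix.ext_iff, Fin.forall_fin_two, Fin.sum_univ_two, he, hb, hf]
      linear_combination conj e * I_sq
    · have hf' := conj_ne_zero hf
      refine NormalForm.r2'_J2.inKahlerTable H !![conj e / (f * conj f), -1 / f; 1, 0] ?_ ?_ ?_ <;>
        simp [nullMatrices, ← Matrix.ext_iff, Fin.forall_fin_two, Fin.sum_univ_two, hb, hf]
      field_simp
      ring
  · have hb' := conj_ne_zero hb
    obtain rfl : f = -b := by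
      have h : b * conj (b + f) = 0 := by
        simp only [map_zero] at E₇
        simp only [map_add]
        linear_combination -E₇
      exact eq_neg_of_add_eq_zero_right
        ((map_eq_zero conj).1 ((mul_eq_zero.1 h).resolve_left hb))
    refine NormalForm.r4.inKahlerTable H !![-conj e / (4 * b * conj b), -1 / (2 * b); 1, 0]
      ?_ ?_ ?_ <;>
      simp [nullMatrices, ← Matrix.ext_iff, Fin.forall_fin_two, Fin.sum_univ_two, conj_ofNat,
        hb] <;>
      (try constructorm* _ ∧ _) <;> field_simp
    all_goals ring

theorem inKahlerTable_null (H : D.HasStructureConstants (nullMatrices a b c d e f) ![c - b, d])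
    (hV : ¬IsLieAbelian V) : InKahlerTable V := by
  by_cases hd : d = 0
  · subst hd
    by_cases ha : a = 0
    · subst ha
      by_cases hc : c = 0
      · subst hc
        exact H.inKahlerTable_null_of_matrix_zero_eq_zero hV
      · exact H.inKahlerTable_null_of_c_ne_zero hc
    · exact H.inKahlerTable_null_of_a_ne_zero ha
  · exact H.inKahlerTable_null_of_d_ne_zero hd

end HolomorphicSplitting.HasStructureConstants

end NullFrames

section NonNullFrames

open Complex ComplexConjugate Matrix

variable {V : Type*} [LieRing V] [LieAlgebra ℝ V] [Module ℂ V] {D : HolomorphicSplitting V}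
  {ε : ℝ} {a b c d e f : ℂ}

/-- The matrices of structure constants in an orthogonal basis whose second vector is an eigenvector
of all `D.M x` and whose vectors are not null, `ε` being the quotient of their norms. The
compatibility of the metric then forces `D.S` to have the components `c - b` and `d`. -/
noncomputable def nonNullMatrices (ε : ℝ) (a b c d e f : ℂ) : Fin 2 → Matrix (Fin 2) (Fin 2) ℂ :=
  ![!![-conj a, -ε * conj c; 0, -conj d], !![-conj b, -ε * conj e; 0, -conj f]]

theorem nonNullMatrices_zero : nonNullMatrices ε 0 0 0 0 0 0 = 0 := by
  ext i j k
  fin_cases i <;> fin_cases j <;> fin_cases k <;> simp [nonNullMatrices]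

namespace HolomorphicSplitting.HasStructureConstants

theorem nonNull_relations (H : D.HasStructureConstants (nonNullMatrices ε a b c d e f) ![c - b, d])
    (hε : ε ≠ 0) :
    ((c - b) * a + d * b = 0 ∧ c ^ 2 + 2 * d * e = e * a + f * c ∧ d * (c - b + f) = 0) ∧
    conj f * (c - b) = f * conj b ∧ ε * conj e * (c - b + f) = d * (conj b + conj f) ∧
    conj d * (c - b) = conj a * b + ε * e * conj b ∧
    ε * c * conj c + ε ^ 2 * e * conj e = conj a * d + a * conj d + ε * c * conj f := by
  have hε' : (ε : ℂ) ≠ 0 := ofReal_ne_zero.2 hε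
  have hM := congrArg (map · conj) H.jacobi_M
  have hS₀ := H.jacobi_S 0
  have hS₁ := H.jacobi_S 1
  simp only [← Matrix.ext_iff, Fin.forall_fin_two, funext_iff] at hM hS₀ hS₁
  simp [nonNullMatrices, Fin.sum_univ_two, trace_fin_two, vecHead, vecTail] at hM hS₀ hS₁
  obtain ⟨⟨E₁, E₂⟩, E₃⟩ := hM
  obtain ⟨E₆, E₇⟩ := hS₀
  obtain ⟨E₄, E₅⟩ := hS₁
  refine ⟨⟨?_, ?_, ?_⟩, ?_, ?_, ?_, ?_⟩
  · linear_combination E₁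
  · exact mul_left_cancel₀ hε' (by linear_combination E₂)
  · linear_combination E₃
  · linear_combination E₄
  · linear_combination -E₅
  · linear_combination E₆
  · linear_combination -E₇

variable [IsScalarTower ℝ ℂ V]

theorem inKahlerTable_nonNull_of_f_ne_zero
    (H : D.HasStructureConstants (nonNullMatrices ε a b (b - f) d e f) ![b - f - b, d])
    (hε : ε ≠ 0) (hf : f ≠ 0) : InKahlerTable V := by
  obtain ⟨⟨E₁, E₂, -⟩, E₄, -, E₆, -⟩ := H.nonNull_relations hε
  have hf' := conj_ne_zero hf
  obtain rfl : b = -f := by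
    have h : f * conj (b + f) = 0 := by
      simp only [map_add]
      linear_combination -E₄
    exact eq_neg_of_add_eq_zero_left ((map_eq_zero conj).1 ((mul_eq_zero.1 h).resolve_left hf))
  obtain rfl : d = -a := mul_left_cancel₀ hf (by linear_combination -E₁)
  replace E₂ := congrArg conj E₂
  replace E₆ := congrArg conj E₆
  simp only [map_sub, map_add, map_mul, map_neg, conj_conj, conj_ofReal, map_pow, conj_ofNat]
    at E₂ E₆
  refine NormalForm.r4.inKahlerTable H !![0, -1 / (2 * f); f, a] ?_ ?_ ?_ <;>
    simp [nonNullMatrices, ← Matrix.ext_iff, Fin.forall_fin_two, Fin.sum_univ_two, conj_ofNat,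
      hf] <;>
    (try constructorm* _ ∧ _) <;> field_simp
  all_goals first | (simp; done) | ring1 | linear_combination E₆ | linear_combination f * ε / 3 * E₂

theorem inKahlerTable_nonNull_of_b_ne_zero
    (H : D.HasStructureConstants (nonNullMatrices ε a b b d e 0) ![b - b, d])
    (hε : ε ≠ 0) (hb : b ≠ 0) : InKahlerTable V := by
  obtain ⟨⟨E₁, E₂, -⟩, -, -, E₆, -⟩ := H.nonNull_relations hε
  obtain rfl : d = 0 := (mul_eq_zero.1 (by linear_combination E₁)).resolve_right hb
  have hb' := conj_ne_zero hb
  replace E₂ := congrArg conj E₂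
  replace E₆ := congrArg conj E₆
  simp only [map_sub, map_add, map_mul, map_zero, conj_conj, conj_ofReal, map_pow] at E₂ E₆
  refine NormalForm.r2'_J2.inKahlerTable H !![0, -1 / b; b, -a] ?_ ?_ ?_ <;>
    simp [nonNullMatrices, ← Matrix.ext_iff, Fin.forall_fin_two, Fin.sum_univ_two, hb] <;>
    (try constructorm* _ ∧ _) <;> field_simp
  all_goals first | ring1 | linear_combination E₆ | linear_combination -ε * E₂

theorem inKahlerTable_nonNull_of_matrix_one_eq
    (H : D.HasStructureConstants (nonNullMatrices ε a 0 0 d e 0) ![0 - 0, d]) (hε : ε ≠ 0)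
    (hV : ¬IsLieAbelian V) : InKahlerTable V := by
  obtain ⟨⟨-, E₂, -⟩, -, -, -, E₇⟩ := H.nonNull_relations hε
  by_cases he : e = 0
  · by_cases hd : d = 0
    · by_cases ha : a = 0
      · have hs : (![0 - 0, 0] : Fin 2 → ℂ) = 0 := by simp
        rw [ha, hd, he, nonNullMatrices_zero, hs] at H
        exact absurd H.isLieAbelian hV
      · refine inKahlerTable_product (D := D) (a := a) (f := 0) ?_ (Or.inl ha)
        refine H.change 1 ?_ ?_ ?_ <;>
          simp [nonNullMatrices, ← Matrix.ext_iff, Fin.forall_fin_two, Fin.sum_univ_two, hd, he]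
    · refine inKahlerTable_rotation (D := D) (b := d) (f := a) ?_ hd ?_
      · refine H.change 1 ?_ ?_ ?_ <;>
          simp [nonNullMatrices, ← Matrix.ext_iff, Fin.forall_fin_two, Fin.sum_univ_two, he]
      · simp only [he, map_zero, mul_zero] at E₇
        linear_combination -E₇
  · obtain rfl : a = 2 * d := mul_left_cancel₀ he (by linear_combination -E₂)
    simp only [map_zero, map_mul, conj_ofNat, mul_zero] at E₇
    have hd : d ≠ 0 := by
      rintro rfl
      have := conj_ne_zero he
      exact absurd E₇ (by simp [hε, he])
    refine inKahlerTable_d42 (D := D) (d := d) (u := ε * e) ?_ hd ?_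
    · refine H.change 1 ?_ ?_ ?_ <;>
        simp [nonNullMatrices, ← Matrix.ext_iff, Fin.forall_fin_two, Fin.sum_univ_two, conj_ofNat]
    · simp only [map_mul, conj_ofReal]
      linear_combination E₇

theorem inKahlerTable_nonNull_of_add_ne_zero
    (H : D.HasStructureConstants (nonNullMatrices ε a b c 0 0 f) ![c - b, 0]) (hε : ε ≠ 0)
    (hg : c - b + f ≠ 0) : InKahlerTable V := by
  obtain ⟨⟨E₁, E₂, -⟩, E₄, -, E₆, -⟩ := H.nonNull_relations hε
  by_cases ha : a = 0
  · by_cases hc : c = 0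
    · by_cases hb : b = 0
      · refine inKahlerTable_product (D := D) (a := 0) (f := f) ?_ (Or.inr ?_)
        · refine H.change 1 ?_ ?_ ?_ <;>
            simp [nonNullMatrices, ← Matrix.ext_iff, Fin.forall_fin_two, Fin.sum_univ_two, ha, hb,
              hc]
        · rintro rfl
          simp [hb, hc] at hg
      · refine inKahlerTable_rotation (D := D) (b := b) (f := f) ?_ hb ?_
        · refine H.change !![0, 1; 1, 0] ?_ ?_ ?_ <;>
            simp [nonNullMatrices, ← Matrix.ext_iff, Fin.forall_fin_two, Fin.sum_univ_two, ha, hc]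
        · rw [hc] at E₄
          linear_combination -E₄
    · obtain rfl : c = f := mul_left_cancel₀ hc (by linear_combination E₂)
      refine inKahlerTable_hyperbolic (D := D) (b := b) (f := c) (ε := ε) ?_ hc hε ?_
      · refine H.change !![0, 1; 1, 0] ?_ ?_ ?_ <;>
          simp [nonNullMatrices, ← Matrix.ext_iff, Fin.forall_fin_two, Fin.sum_univ_two, ha]
      · linear_combination E₄
  · obtain rfl : b = 0 := by
      refine (mul_eq_zero.1 ?_).resolve_left (conj_ne_zero ha)
      simp only [map_zero] at E₆
      linear_combination -E₆
    obtain rfl : c = 0 := mul_right_cancel₀ ha (by linear_combination E₁)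
    refine inKahlerTable_product (D := D) (a := a) (f := f) ?_ (Or.inl ha)
    refine H.change 1 ?_ ?_ ?_ <;>
      simp [nonNullMatrices, ← Matrix.ext_iff, Fin.forall_fin_two, Fin.sum_univ_two]

theorem inKahlerTable_nonNull
    (H : D.HasStructureConstants (nonNullMatrices ε a b c d e f) ![c - b, d]) (hε : ε ≠ 0)
    (hV : ¬IsLieAbelian V) : InKahlerTable V := by
  obtain ⟨⟨-, -, E₃⟩, -, E₅, -, -⟩ := H.nonNull_relations hε
  by_cases hg : c - b + f = 0
  · obtain rfl : c = b - f := by linear_combination hg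
    by_cases hf : f = 0
    · rw [hf, sub_zero] at H
      by_cases hb : b = 0
      · rw [hb] at H
        exact H.inKahlerTable_nonNull_of_matrix_one_eq hε hV
      · exact H.inKahlerTable_nonNull_of_b_ne_zero hε hb
    · exact H.inKahlerTable_nonNull_of_f_ne_zero hε hf
  · obtain rfl : d = 0 := (mul_eq_zero.1 E₃).resolve_right hg
    obtain rfl : e = 0 := by simpa [hε, hg] using E₅
    exact H.inKahlerTable_nonNull_of_add_ne_zero hε hg

end HolomorphicSplitting.HasStructureConstants

end NonNullFrames

section AdaptedBases

open Complex ComplexConjugate Module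

variable {V : Type*} [AddCommGroup V] [Module ℂ V] {h : V →ₗ⋆[ℂ] V →ₗ[ℂ] ℂ}

theorem exists_basis_fin_two {K W : Type*} [Field K] [AddCommGroup W] [Module K W]
    (hW : finrank K W = 2) {p q : W} (hpq : LinearIndependent K ![p, q]) :
    ∃ b : Basis (Fin 2) K W, b 0 = p ∧ b 1 = q :=
  ⟨basisOfLinearIndependentOfCardEqFinrank hpq (by simp [hW]), by simp, by simp⟩

theorem exists_eq_smul_add_smul {K W : Type*} [Semiring K] [AddCommMonoid W] [Module K W]
    (b : Basis (Fin 2) K W) (x : W) : ∃ α β : K, x = α • b 0 + β • b 1 :=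
  ⟨b.repr x 0, b.repr x 1, by
    rw [← Fin.sum_univ_two fun i => b.repr x i • b i, b.sum_repr]⟩

theorem exists_hyperbolic_pair (hsymm : h.IsSymm) (hsep : h.SeparatingLeft) {p : V} (hp : p ≠ 0)
    (hpp : h p p = 0) : ∃ q, h p q = 1 ∧ h q q = 0 := by
  obtain ⟨y, hy⟩ : ∃ y, h p y ≠ 0 := by
    by_contra! hp₀
    exact hp (hsep p hp₀)
  obtain ⟨z, hpz⟩ : ∃ z, h p z = 1 := ⟨(h p y)⁻¹ • y, by simp [hy]⟩
  have hzp : h z p = 1 := by rw [← hsymm.eq p z, hpz, map_one]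
  have hzz : conj (h z z) = h z z := hsymm.eq z z
  refine ⟨z - (h z z / 2) • p, by simp [hpp, hpz], ?_⟩
  simp only [map_sub, map_smulₛₗ, LinearMap.sub_apply, LinearMap.smul_apply, hpz, hzp, hpp, hzz,
    map_div₀, conj_ofNat, RingHom.id_apply, smul_eq_mul]
  ring

theorem exists_basis_hyperbolic (hV : finrank ℂ V = 2) (hsymm : h.IsSymm)
    (hsep : h.SeparatingLeft) {p : V} (hp : p ≠ 0) (hpp : h p p = 0) :
    ∃ b : Basis (Fin 2) ℂ V, b 0 = p ∧ h p (b 1) = 1 ∧ h (b 1) p = 1 ∧ h (b 1) (b 1) = 0 := by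
  obtain ⟨q, hpq, hqq⟩ := exists_hyperbolic_pair hsymm hsep hp hpp
  have hqp : h q p = 1 := by rw [← hsymm.eq p q, hpq, map_one]
  have hind : LinearIndependent ℂ ![p, q] := LinearIndependent.pair_iff.2 fun s t hst =>
    ⟨by simpa [hqp, hqq] using congrArg (h q) hst, by simpa [hpp, hpq] using congrArg (h p) hst⟩
  obtain ⟨b, hb₀, hb₁⟩ := exists_basis_fin_two hV hind
  exact ⟨b, hb₀, by rwa [hb₁], by rwa [hb₁], by rwa [hb₁]⟩

theorem exists_basis_orthogonal (hV : finrank ℂ V = 2) (hsymm : h.IsSymm)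
    (hsep : h.SeparatingLeft) {q : V} (hqq : h q q ≠ 0) :
    ∃ b : Basis (Fin 2) ℂ V, b 1 = q ∧ h (b 0) q = 0 ∧ h q (b 0) = 0 ∧ h (b 0) (b 0) ≠ 0 := by
  obtain ⟨y, hy⟩ : ∃ y, ∀ c : ℂ, c • q ≠ y := by
    by_contra! hq
    have := finrank_le_one q hq
    omega
  obtain ⟨p, hp, hqp⟩ : ∃ p ≠ 0, h q p = 0 :=
    ⟨y - (h q y / h q q) • q, fun h₀ => hy _ (sub_eq_zero.1 h₀).symm, by simp [hqq]⟩
  have hpq : h p q = 0 := by rw [← hsymm.eq q p, hqp, map_zero]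
  have hind : LinearIndependent ℂ ![p, q] := LinearIndependent.pair_iff.2 fun s t hst => by
    obtain rfl : t = 0 := by simpa [hqp, hqq] using congrArg (h q) hst
    simpa [hp] using hst
  obtain ⟨b, rfl, rfl⟩ := exists_basis_fin_two hV hind
  refine ⟨b, rfl, hpq, hqp, fun hpp => hp (hsep _ fun y => ?_)⟩
  rw [← b.sum_repr y, Fin.sum_univ_two, map_add, map_smul, map_smul, hpp, hpq]
  simp

end AdaptedBases

section AdaptedStructureConstants

open Complex ComplexConjugate Module

variable {V : Type*} [LieRing V] [LieAlgebra ℝ V] [Module ℂ V] {D : HolomorphicSplitting V}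
  {h : V →ₗ⋆[ℂ] V →ₗ[ℂ] ℂ}

namespace HolomorphicSplitting.IsKahler

theorem exists_null_structureConstants (hD : D.IsKahler h) (hV : finrank ℂ V = 2) {p : V}
    (hp : p ≠ 0) (heig : ∀ x, ∃ c : ℂ, D.M x p = c • p) (hpp : h p p = 0) :
    ∃ a b c d e f : ℂ, D.HasStructureConstants (nullMatrices a b c d e f) ![c - b, d] := by
  obtain ⟨B, rfl, hpq, hqp, hqq⟩ := exists_basis_hyperbolic hV hD.symm hD.separatingLeft hp hpp
  obtain ⟨m₁, e₁⟩ := heig (B 0)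
  obtain ⟨m₅, e₅⟩ := heig (B 1)
  obtain ⟨m₃, m₄, e₃⟩ := exists_eq_smul_add_smul B (D.M (B 0) (B 1))
  obtain ⟨m₇, m₈, e₇⟩ := exists_eq_smul_add_smul B (D.M (B 1) (B 1))
  obtain ⟨s₀, s₁, es⟩ := exists_eq_smul_add_smul B (D.S (B 0) (B 1))
  have hs₀ := congrArg conj (hD.map_S (B 0) (B 1) (B 1))
  have hs₁ := congrArg conj (hD.map_S (B 0) (B 1) (B 0))
  simp only [es, e₁, e₃, e₅, e₇, map_add, map_sub, map_smulₛₗ, LinearMap.add_apply,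
    LinearMap.smul_apply, RingHom.id_apply, smul_eq_mul, conj_conj, hpp, hpq, hqp, hqq,
    mul_one, mul_zero, zero_add, add_zero, zero_sub] at hs₀ hs₁
  refine ⟨-conj m₄, -conj m₈, -conj m₃, -conj m₁, -conj m₇, -conj m₅, B, ?_, ?_⟩
  · simp [Fin.forall_fin_two, Fin.sum_univ_two, nullMatrices, e₁, e₃, e₅, e₇]
  · simp [Fin.sum_univ_two, es, hs₀, hs₁, sub_eq_add_neg, add_comm]

theorem exists_nonNull_structureConstants (hD : D.IsKahler h) (hV : finrank ℂ V = 2) {q : V}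
    (heig : ∀ x, ∃ c : ℂ, D.M x q = c • q) (hqq : h q q ≠ 0) :
    ∃ (ε : ℝ) (a b c d e f : ℂ), ε ≠ 0 ∧
      D.HasStructureConstants (nonNullMatrices ε a b c d e f) ![c - b, d] := by
  obtain ⟨B, rfl, hpq, hqp, hpp⟩ := exists_basis_orthogonal hV hD.symm hD.separatingLeft hqq
  obtain ⟨P, hP⟩ := conj_eq_iff_real.1 (hD.symm.eq (B 0) (B 0))
  obtain ⟨Q, hQ⟩ := conj_eq_iff_real.1 (hD.symm.eq (B 1) (B 1))
  have hP₀ : (P : ℂ) ≠ 0 := hP ▸ hpp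
  have hQ₀ : (Q : ℂ) ≠ 0 := hQ ▸ hqq
  obtain ⟨m₄, e₄⟩ := heig (B 0)
  obtain ⟨m₈, e₈⟩ := heig (B 1)
  obtain ⟨m₁, m₂, e₁⟩ := exists_eq_smul_add_smul B (D.M (B 0) (B 0))
  obtain ⟨m₅, m₆, e₅⟩ := exists_eq_smul_add_smul B (D.M (B 1) (B 0))
  obtain ⟨s₀, s₁, es⟩ := exists_eq_smul_add_smul B (D.S (B 0) (B 1))
  have hs₀ := congrArg conj (hD.map_S (B 0) (B 1) (B 0))
  have hs₁ := congrArg conj (hD.map_S (B 0) (B 1) (B 1))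
  simp only [es, e₁, e₄, e₅, e₈, map_add, map_sub, map_smulₛₗ, LinearMap.add_apply,
    LinearMap.smul_apply, RingHom.id_apply, smul_eq_mul, conj_conj, hP, hQ, hpq, hqp, conj_ofReal,
    map_mul, map_neg, mul_zero, zero_add, add_zero, zero_sub] at hs₀ hs₁
  replace hs₀ : s₀ = -conj m₂ * Q / P - -conj m₅ := by
    field_simp
    linear_combination hs₀
  replace hs₁ : s₁ = -conj m₄ := mul_right_cancel₀ hQ₀ (by linear_combination hs₁)
  refine ⟨P / Q, -conj m₁, -conj m₅, -conj m₂ * Q / P, -conj m₄, -conj m₆ * Q / P, -conj m₈,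
    div_ne_zero (ofReal_ne_zero.1 hP₀) (ofReal_ne_zero.1 hQ₀), B, ?_, ?_⟩
  · simp [Fin.forall_fin_two, Fin.sum_univ_two, nonNullMatrices, e₁, e₄, e₅, e₈]
    field_simp
    exact ⟨by module, by module⟩
  · simp [Fin.sum_univ_two, es, hs₀, hs₁]

variable [IsScalarTower ℝ ℂ V]

theorem inKahlerTable (hD : D.IsKahler h) (hV : finrank ℂ V = 2) (hab : ¬IsLieAbelian V) :
    InKahlerTable V := by
  obtain ⟨w, hw, heig⟩ := D.exists_eigenvector hV
  by_cases hww : h w w = 0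
  · obtain ⟨a, b, c, d, e, f, H⟩ := hD.exists_null_structureConstants hV hw heig hww
    exact H.inKahlerTable_null hab
  · obtain ⟨ε, a, b, c, d, e, f, hε, H⟩ := hD.exists_nonNull_structureConstants hV heig hww
    exact H.inKahlerTable_nonNull hε hab

end HolomorphicSplitting.IsKahler

end AdaptedStructureConstants

open Module in
theorem exists_kahlerTable_equiv {g : Type*} [LieRing g] [LieAlgebra ℝ g] (hg : finrank ℝ g = 4)
    (hab : ¬IsLieAbelian g) {J : g →ₗ[ℝ] g} {ω : LinearMap.BilinForm ℝ g}
    (hJ : IsKahlerStructure J ω) :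
    ∃ (A : LieName) (J₀ : A.Alg →ₗ[ℝ] A.Alg) (S : Set (LinearMap.BilinForm ℝ A.Alg))
      (φ : g ≃ₗ⁅ℝ⁆ A.Alg), KahlerTable A J₀ S ∧ ∀ x, φ (J x) = J₀ (φ x) := by
  let Φ : ℂ →ₐ[ℝ] End ℝ g := Complex.lift ⟨J, LinearMap.ext hJ.1.1⟩
  let : Module ℂ g := Module.compHom g Φ.toRingHom
  have hsmul (c : ℂ) (x : g) : c • x = Φ c x := rfl
  have : IsScalarTower ℝ ℂ g := ⟨fun r c x => by
    rw [hsmul, hsmul, map_smul, LinearMap.smul_apply]⟩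
  have hJI : J = mulI g := LinearMap.ext fun x => by
    rw [mulI_apply, hsmul]
    simp [Φ]
  have hV : finrank ℂ g = 2 := by
    have := finrank_mul_finrank ℝ ℂ g
    rw [Complex.finrank_real_complex, hg] at this
    omega
  rw [hJI] at hJ ⊢
  exact (isKahler_hermitianForm hJ.1 hJ.2).inKahlerTable hV hab

theorem KahlerTable.not_isLieAbelian {A : LieName} {J : A.Alg →ₗ[ℝ] A.Alg}
    {S : Set (LinearMap.BilinForm ℝ A.Alg)} (h : KahlerTable A J S) : ¬IsLieAbelian A.Alg := by
  intro hab
  have hA (i j k : Fin 4) : A.bracket (A.e i) (A.e j) k = 0 :=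
    congrFun (trivial_lie_zero A.Alg A.Alg (A.e i) (A.e j)) k
  simp only [LieName.e_eq_single] at hA
  have h₁ := hA 0 1 1
  have h₂ := hA 0 1 2
  have h₃ := hA 0 2 2
  have h₄ := hA 3 0 0
  cases h <;> simp [LieName.bracket] at h₁ h₂ h₃ h₄

theorem LieName.finrank_alg (A : LieName) : Module.finrank ℝ A.Alg = 4 := by
  rw [Module.finrank_eq_card_basis A.basis, Fintype.card_fin]

theorem comp_mem_compatibleSymplectic {g g' : Type*} [LieRing g] [LieAlgebra ℝ g] [LieRing g']
    [LieAlgebra ℝ g'] (ψ : g' ≃ₗ⁅ℝ⁆ g) {J : g →ₗ[ℝ] g} {J' : g' →ₗ[ℝ] g'}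
    (hψ : ∀ x, ψ (J' x) = J (ψ x)) {ω : LinearMap.BilinForm ℝ g}
    (hω : ω ∈ compatibleSymplectic J) :
    ω.compl₁₂ (ψ : g' →ₗ[ℝ] g) (ψ : g' →ₗ[ℝ] g) ∈ compatibleSymplectic J' := by
  obtain ⟨⟨halt, hcl, hnd⟩, hinv⟩ := hω
  refine ⟨⟨fun x => halt _, fun x y z => ?_, fun x hx => ?_⟩, fun x y => ?_⟩
  · simpa [LieEquiv.map_lie] using hcl (ψ x) (ψ y) (ψ z)
  · refine ψ.injective ((hnd _ fun y => ?_).trans (map_zero (ψ : g' →ₗ[ℝ] g)).symm)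
    obtain ⟨y, rfl⟩ := ψ.surjective y
    exact hx y
  · simpa [hψ] using hinv (ψ x) (ψ y)

theorem mainTheorem1 :
    -- every non-abelian four-dimensional Kähler Lie algebra is isomorphic to one in the table
    (∀ (g : Type*) [LieRing g] [LieAlgebra ℝ g], Module.finrank ℝ g = 4 → ¬ IsLieAbelian g →
      ∀ (J : g →ₗ[ℝ] g) (ω : LinearMap.BilinForm ℝ g), IsKahlerStructure J ω →
        ∃ (A : LieName) (J₀ : A.Alg →ₗ[ℝ] A.Alg) (S : Set (LinearMap.BilinForm ℝ A.Alg))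
          (φ : g ≃ₗ⁅ℝ⁆ A.Alg), KahlerTable A J₀ S ∧ (∀ x, φ (J x) = J₀ (φ x)) ∧
            ∃ ω₀ ∈ S, ∀ x y, ω x y = ω₀ (φ x) (φ y)) ∧
    -- on each Lie algebra of the table, every complex structure that admits a compatible symplectic
    -- form is equivalent to one listed for that Lie algebra
    (∀ (A : LieName), (∃ J₁ S₁, KahlerTable A J₁ S₁) →
      ∀ (J : A.Alg →ₗ[ℝ] A.Alg), IsComplexStructure J → (compatibleSymplectic J).Nonempty →
        ∃ (J₀ : A.Alg →ₗ[ℝ] A.Alg) (S : Set (LinearMap.BilinForm ℝ A.Alg))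
          (φ : A.Alg ≃ₗ⁅ℝ⁆ A.Alg), KahlerTable A J₀ S ∧ ∀ x, φ (J x) = J₀ (φ x)) ∧
    -- each listed endomorphism is a complex structure, and its compatible symplectic forms are
    -- exactly the listed two-forms
    (∀ (A : LieName) (J₀ : A.Alg →ₗ[ℝ] A.Alg) (S : Set (LinearMap.BilinForm ℝ A.Alg)),
      KahlerTable A J₀ S → IsComplexStructure J₀ ∧ compatibleSymplectic J₀ = S) := by
  refine ⟨fun g _ _ hg hab J ω hJ => ?_, fun A ⟨J₁, S₁, h₁⟩ J hJ ⟨ω, hω⟩ => ?_,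
    fun A J₀ S h => ⟨h.isComplexStructure, h.compatibleSymplectic_eq⟩⟩
  · obtain ⟨A, J₀, S, φ, h, hφ⟩ := exists_kahlerTable_equiv hg hab hJ
    refine ⟨A, J₀, S, φ, h, hφ, ω.compl₁₂ (φ.symm : A.Alg →ₗ[ℝ] g) (φ.symm : A.Alg →ₗ[ℝ] g), ?_,
      fun x y => by simp⟩
    rw [← h.compatibleSymplectic_eq]
    refine comp_mem_compatibleSymplectic φ.symm (fun x => ?_) hJ.2
    obtain ⟨y, rfl⟩ := φ.surjective x
    change φ.symm (J₀ (φ y)) = J (φ.symm (φ y))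
    rw [← hφ, φ.symm_apply_apply, φ.symm_apply_apply]
  · obtain ⟨A', J₀, S, φ, h, hφ⟩ :=
      exists_kahlerTable_equiv A.finrank_alg h₁.not_isLieAbelian ⟨hJ, hω⟩
    obtain rfl := h₁.isTabulated.eq_of_equiv h.isTabulated φ
    exact ⟨J₀, S, φ, h, hφ⟩
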